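/- A network consists of $C$ parallel noiseless binary links; $\mathcal W$ is a nonempty family of subsets of the links, and the eavesdropper Willie observes the links of one unknown $W\in\mathcal W$. Logarithms are to base $2$; for a distribution $p$ on $\{0,1\}^C$, $p_W$ is its marginal on the coordinates in $W$, and $H$ is Shannon entropy. Let $p^i$ be a distribution on $\{0,1\}^C$. Over $n$ network uses, an innocent Alice sends a $C\times n$ matrix $\mathbf X$ with i.i.d. columns distributed as $p^i$. A scheme of block length $n$ with $k$ message bits and $l$ private random bits consists of an encoder $\mathrm{Enc}:\{0,1\}^k\times\{0,1\}^l\to\{0,1\}^{C\times n}$ and of Bob's estimates $\hat T$ of Alice's status $T\in\{0,1\}$ ($0$ innocent, $1$ active) and $\hat M$ of her message, both functions of the transmitted matrix; an active Alice sends $\mathbf X=\mathrm{Enc}(M,S)$ with $M,S$ independent and uniform. Its rate is $k/n$. The scheme is - $(1-\varepsilon)$-reliable if $\Pr(\hat T=1\mid T=0)+\Pr(\hat T=0\mid T=1)+\Pr(\hat M\neq M\mid T=1)\le\varepsilon$; - $(1-\varepsilon)$-deniable if, for every $W\in\mathcal W$, the distributions of the observed rows $\mathbf X_W$ given $T=0$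 and given $T=1$ are at total variation distance less than $\varepsilon$; - $(1-\varepsilon)$-hidable if $1-\varepsilon\le\Pr(M=m\mid\mathbf X_W=\mathbf y,\,T=1)/\Pr(M=m\mid T=1)\le1+\varepsilon$ for all messages $m$, all $W\in\mathcal W$ and all $\mathbf y$ with $\Pr(\mathbf X_W=\mathbf y\mid T=1)>0$. A rate $R\ge0$ is achievable if there is $r\ge0$ such that for all $\varepsilon_{\mathrm{rel}},\varepsilon_{\mathrm{den}},\varepsilon_{\mathrm{hid}}>0$ and all sufficiently large $n$ there is a scheme with $\lceil nR\rceil$ message bits and $\lceil nr\rceil$ private random bits that is simultaneously $(1-\varepsilon_{\mathrm{rel}})$-reliable, $(1-\varepsilon_{\mathrm{den}})$-deniable and $(1-\varepsilon_{\mathrm{hid}})$-hidable. The capacity $C_{\mathrm{hd}}$ is the supremum of the achievable rates ($0$ if there are none). Theorem. With $X\sim p$, $$C_{\mathrm{hd}}=\sup_{p:\ p_W=p^i_W\ \forall W\in\mathcal W}\ \min_{W\in\mathcal W}\bigl[H(p)-H(p_W)\bigr]=\sup_{p:\ p_W=p^i_W\ \forall W\in\mathcal W}\ \min_{W\in\mathcal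 W}H(X_{W^c}\mid X_W).$$ Every rate $0\le R<C_{\mathrm{hd}}$ is achievable. Conversely, for every $R>C_{\mathrm{hd}}$ there is $\delta>0$ such that no scheme of any block length $n\ge1$, with any number of private random bits and with rate at least $R$, is simultaneously $(1-\delta)$-reliable, $(1-\delta)$-deniable and $(1-\delta)$-hidable. -/

import Mathlib

namespace MultipathNet

/-! ### Finite distributions, entropy in bits, total variation -/

section Finite

variable {α β : Type*} [Fintype α] [Fintype β]

/-- The distribution of `f X` when `X` has distribution `p`. -/
noncomputable def push [DecidableEq β] (f : α → β) (p : α → ℝ) (b : β) : ℝ :=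
  ∑ a, if f a = b then p a else 0

/-- Shannon entropy in bits, with `0 log 0 = 0`. -/
noncomputable def entropy (p : α → ℝ) : ℝ :=
  -∑ a, p a * Real.logb 2 (p a)

/-- Conditional entropy `H(B | A) = ∑ₐ P(A = a) H(B | A = a)` in bits, where `J` is the joint
distribution of `(A, B)`. The values `a` with `P(A = a) = 0` contribute `0`. -/
noncomputable def condEntropy (J : α × β → ℝ) : ℝ :=
  ∑ a, (∑ b, J (a, b)) * entropy (fun b => J (a, b) / ∑ b', J (a, b'))

/-- Total variation distance. -/
noncomputable def tvDist (p q : α → ℝ) : ℝ :=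
  (1 / 2) * ∑ a, |p a - q a|

end Finite

/-! ### The network -/

/-- What is sent on the `C` links in one network use. -/
abbrev Symbol (C : ℕ) : Type := Fin C → Bool

/-- A `C × n` binary codeword matrix, stored by columns: `x t i` is the bit sent on link `i` in
network use `t`. -/
abbrev Codeword (C n : ℕ) : Type := Fin n → Symbol C

/-- Binary strings of length `k`. -/
abbrev Bits (k : ℕ) : Type := Fin k → Bool

/-- The part of a symbol carried by the links in `W`. -/
def restrict {C : ℕ} (W : Finset (Fin C)) (x : Symbol C) : W → Bool :=
  fun i => x i

/-- The part of a codeword matrix carried by the links in `W`. -/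
def observe {C n : ℕ} (W : Finset (Fin C)) (x : Codeword C n) : Fin n → W → Bool :=
  fun t => restrict W (x t)

/-- The marginal `p_W` of a distribution on symbols. -/
noncomputable def marginal {C : ℕ} (p : Symbol C → ℝ) (W : Finset (Fin C)) : (W → Bool) → ℝ :=
  push (restrict W) p

/-- `H(X_{Wᶜ} | X_W)` for `X` with distribution `p`. -/
noncomputable def hiddenEntropy {C : ℕ} (p : Symbol C → ℝ) (W : Finset (Fin C)) : ℝ :=
  condEntropy (push (fun x => (restrict W x, restrict Wᶜ x)) p)

/-- The probability distributions on symbols whose marginals on every observable set of links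
agree with those of `pinn`. -/
def matching {C : ℕ} (𝒲 : Finset (Finset (Fin C))) (pinn : Symbol C → ℝ) : Set (Symbol C → ℝ) :=
  {p | p ∈ stdSimplex ℝ (Symbol C) ∧ ∀ W ∈ 𝒲, marginal p W = marginal pinn W}

/-- The innocent distribution: i.i.d. columns with distribution `pinn`. -/
noncomputable def innocent {C : ℕ} (pinn : Symbol C → ℝ) (n : ℕ) (x : Codeword C n) : ℝ :=
  ∏ t, pinn (x t)

/-! ### Communication schemes -/

/-- A scheme with block length `n`, `k` message bits and `l` bits of private randomness: Alice's
encoder, Bob's estimate of her status (`true` means active), and his estimate of her message. -/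
structure Scheme (C n k l : ℕ) where
  enc : Bits k → Bits l → Codeword C n
  decT : Codeword C n → Bool
  decM : Codeword C n → Bits k

/-- Probability of an event over a uniform message and uniform, independent private randomness
(Alice is active). -/
noncomputable def activeProb {k l : ℕ} (E : Bits k → Bits l → Prop)
    [∀ m s, Decidable (E m s)] : ℝ :=
  ∑ m, ∑ s, if E m s then (1 / 2 ^ k) * (1 / 2 ^ l) else 0

namespace Scheme

variable {C n k l : ℕ}

/-- The distribution on codeword matrices induced by the encoder. -/
noncomputable def induced (S : Scheme C n k l) (x : Codeword C n) : ℝ :=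
  activeProb fun m s => S.enc m s = x

/-- `(1 - ε)`-reliability: false alarm plus missed detection plus decoding error. -/
def Reliable (S : Scheme C n k l) (pinn : Symbol C → ℝ) (ε : ℝ) : Prop :=
  (∑ x, if S.decT x = true then innocent pinn n x else 0)
    + activeProb (fun m s => S.decT (S.enc m s) = false)
    + activeProb (fun m s => S.decM (S.enc m s) ≠ m) ≤ ε

/-- `(1 - ε)`-deniability. -/
def Deniable (S : Scheme C n k l) (𝒲 : Finset (Finset (Fin C))) (pinn : Symbol C → ℝ)
    (ε : ℝ) : Prop :=
  ∀ W ∈ 𝒲, tvDist (push (observe W) (innocent pinn n)) (push (observe W) S.induced) < ε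

/-- `(1 - ε)`-hidability: for every message `m` and every `y` that Willie can observe on `W`
(i.e. with positive probability when Alice is active), `P(M = m | X_W = y) / P(M = m)` lies in
`[1 - ε, 1 + ε]`. -/
def Hidable (S : Scheme C n k l) (𝒲 : Finset (Finset (Fin C))) (ε : ℝ) : Prop :=
  ∀ m : Bits k, ∀ W ∈ 𝒲, ∀ y : Fin n → W → Bool,
    0 < activeProb (fun m' s => observe W (S.enc m' s) = y) →
    (activeProb (fun m' s => m' = m ∧ observe W (S.enc m' s) = y)
        / activeProb (fun m' s => observe W (S.enc m' s) = y))
      / activeProb (fun (m' : Bits k) (_ : Bits l) => m' = m) ∈ Set.Icc (1 - ε) (1 + ε)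

end Scheme

/-- The rate `R` is achievable for reliable, deniable and hidable communication: with some rate
`r` of private randomness, for all tolerances and all sufficiently large `n` there is a scheme
with `⌈n R⌉` message bits and `⌈n r⌉` private random bits that meets the three tolerances. -/
def Achievable {C : ℕ} (𝒲 : Finset (Finset (Fin C))) (pinn : Symbol C → ℝ) (R : ℝ) : Prop :=
  ∃ r : ℝ, 0 ≤ r ∧ ∀ εrel > 0, ∀ εden > 0, ∀ εhid > 0, ∃ N : ℕ, ∀ n ≥ N,
    ∃ S : Scheme C n ⌈n * R⌉₊ ⌈n * r⌉₊,
      S.Reliable pinn εrel ∧ S.Deniable 𝒲 pinn εden ∧ S.Hidable 𝒲 εhid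

/-- The capacity of reliable, deniable and hidable communication: the supremum of the achievable
rates (`0` if there is none). -/
noncomputable def capacity {C : ℕ} (𝒲 : Finset (Finset (Fin C))) (pinn : Symbol C → ℝ) : ℝ :=
  sSup {R : ℝ | 0 ≤ R ∧ Achievable 𝒲 pinn R}

end MultipathNet

/-!
The capacity formula follows from two bounds on the rates at which schemes exist.

**Converse** (`success_mul_log_le`, `Scheme.message_bits_le`, `exists_tolerance_of_lt`). Let `P` be
the law of the transmitted block and `q` the law of its column at a uniformly random time. On the
event that Bob decodes correctly, the block determines the message, and by hidability the
probability of a message together with an observation is at most about `2 ^ (-k)` times that of the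
observation. A single use of `log y ≤ y - 1`, comparing the block restricted to this event with the
law that keeps the observation on `W` and redraws the hidden links column by column from
`q (· | observation)`, gives `k (1 - δ) ≤ n (H(q) - H(q_W)) + o(1)` for every `W`. It
replaces Fano's inequality, subadditivity and concavity of the conditional entropy, and its error
terms do not grow with the block length. Deniability makes the marginals of `q` on observable sets
close to the innocent ones. As the tolerances vanish, the laws `q` accumulate at a matching
distribution because the simplex is compact, and entropy is continuous.

**Achievability** (`exists_pruned`, `exists_codebook`, `exists_scheme`, `achievable_of_lt`). For a
matching `p` and `R < min_W [H(p) - H(p_W)]`, take private randomness of rate `r` with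
`max_W H(p_W) < r < H(p) - R`, and draw a codeword independently for each message and each value of
the private randomness. The i.i.d. law of `p` is first conditioned on typical blocks, and then
pruned: observations of small probability are discarded until every observation that is left has
probability at least about `2 ^ (-n (r - δ))`. As there are few typical observations, this costs
little. Since `r` exceeds the entropy of each observation, a Chernoff bound that is doubly
exponential in `n` survives the union over all messages and observations, so that every message
has almost the same number of codewords behind every observation. This is hidability in its
pointwise form, and it also makes the observations look innocent, because `p_W` is the innocent
marginal. Bob declares Alice active when he receives a codeword: as `R + r < H(p)`, codewords are
too few to collide or to be hit by an innocent matrix.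
-/

namespace MultipathNet

/-! ### Images of distributions and entropy -/

section Push

variable {α β γ : Type*} [Fintype α] [DecidableEq β]

theorem push_nonneg (f : α → β) {p : α → ℝ} (hp : ∀ a, 0 ≤ p a) (b : β) : 0 ≤ push f p b :=
  Finset.sum_nonneg fun a _ => by split_ifs <;> simp [hp a]

theorem le_push (f : α → β) {p : α → ℝ} (hp : ∀ a, 0 ≤ p a) (a : α) : p a ≤ push f p (f a) := by
  have := Finset.single_le_sum (f := fun a' => if f a' = f a then p a' else 0)
    (fun a' _ => by split_ifs <;> simp [hp a']) (Finset.mem_univ a)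
  simpa [push] using this

theorem sum_push_mul [Fintype β] (f : α → β) (p : α → ℝ) (g : β → ℝ) :
    ∑ b, push f p b * g b = ∑ a, p a * g (f a) := by
  simp only [push, Finset.sum_mul]
  rw [Finset.sum_comm]
  refine Finset.sum_congr rfl fun a _ => ?_
  simp [ite_mul]

theorem sum_push [Fintype β] (f : α → β) (p : α → ℝ) : ∑ b, push f p b = ∑ a, p a := by
  simpa using sum_push_mul f p fun _ => 1

theorem push_push [Fintype β] [DecidableEq γ] (f : α → β) (g : β → γ) (p : α → ℝ) :
    push g (push f p) = push (fun a => g (f a)) p := by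
  funext c
  have := sum_push_mul f p fun b => if g b = c then 1 else 0
  simpa [push, mul_ite] using this

theorem entropy_eq (p : α → ℝ) : entropy p = ∑ a, p a * -Real.logb 2 (p a) := by
  simp [entropy]

/-- The conditional entropy of a variable given a function of it, as an expected conditional
surprisal. -/
theorem entropy_sub_entropy_push [Fintype β] (f : α → β) (p : α → ℝ) :
    entropy p - entropy (push f p)
      = ∑ a, p a * (Real.logb 2 (push f p (f a)) - Real.logb 2 (p a)) := by
  have := sum_push_mul f p fun b => Real.logb 2 (push f p b)
  rw [entropy, entropy, this]
  simp only [mul_sub, Finset.sum_sub_distrib]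
  ring

theorem push_apply_of_injective {f : α → β} (hf : Function.Injective f) (p : α → ℝ) (a : α) :
    push f p (f a) = p a := by
  classical
  simp [push, hf.eq_iff]

theorem entropy_push_of_injective [Fintype β] {f : α → β} (hf : Function.Injective f) (p : α → ℝ) :
    entropy (push f p) = entropy p := by
  have := entropy_sub_entropy_push f p
  simp only [push_apply_of_injective hf, sub_self, mul_zero, Finset.sum_const_zero] at this
  linarith

omit [DecidableEq β] in
/-- The chain rule `H(B | A) = H(A, B) - H(A)`. -/
theorem condEntropy_eq [Fintype β] [DecidableEq α] {J : α × β → ℝ} (hJ : ∀ z, 0 ≤ J z) :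
    condEntropy J = entropy J - entropy (push Prod.fst J) := by
  have hmar : ∀ a, push Prod.fst J a = ∑ b, J (a, b) := fun a => by
    rw [push, Fintype.sum_prod_type, Finset.sum_eq_single a (fun a' _ h => by simp [h]) (by simp)]
    simp
  rw [entropy_sub_entropy_push, Fintype.sum_prod_type, condEntropy]
  refine Finset.sum_congr rfl fun a _ => ?_
  simp only [hmar]
  rw [entropy_eq, Finset.mul_sum]
  refine Finset.sum_congr rfl fun b _ => ?_
  rcases (hJ (a, b)).eq_or_lt with h | h
  · simp [← h]
  · have hs : 0 < ∑ b', J (a, b') :=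
      h.trans_le (Finset.single_le_sum (f := fun b' => J (a, b')) (fun _ _ => hJ _)
        (Finset.mem_univ b))
    rw [Real.logb_div h.ne' hs.ne']
    field_simp
    ring

theorem entropy_nonneg {p : α → ℝ} (hp : p ∈ stdSimplex ℝ α) : 0 ≤ entropy p := by
  rw [entropy_eq]
  refine Finset.sum_nonneg fun a _ => mul_nonneg (hp.1 a) ?_
  have h1 : p a ≤ 1 := hp.2 ▸ Finset.single_le_sum (fun a _ => hp.1 a) (Finset.mem_univ a)
  have := Real.logb_nonpos one_lt_two (hp.1 a) h1
  linarith

theorem push_mem_stdSimplex [Fintype β] (f : α → β) {p : α → ℝ} (hp : p ∈ stdSimplex ℝ α) :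
    push f p ∈ stdSimplex ℝ β :=
  ⟨push_nonneg f hp.1, by rw [sum_push, hp.2]⟩

theorem continuous_push (f : α → β) : Continuous fun p : α → ℝ => push f p := by
  refine continuous_pi fun b => continuous_finsetSum _ fun a _ => ?_
  split_ifs <;> fun_prop

theorem continuous_entropy : Continuous (entropy : (α → ℝ) → ℝ) := by
  unfold entropy Real.logb
  refine (continuous_finsetSum _ fun a _ => ?_).neg
  simp_rw [← mul_div_assoc]
  exact (Real.continuous_mul_log.comp (continuous_apply a)).div_const _

/-- Expectation of a product of functions of independent coordinates. -/
theorem sum_prod_pi {ι : Type*} [Fintype ι] [DecidableEq ι] (F : ι → α → ℝ) :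
    ∑ x : ι → α, ∏ t, F t (x t) = ∏ t, ∑ a, F t a :=
  (Fintype.prod_sum F).symm

end Push

theorem hiddenEntropy_eq {C : ℕ} {p : Symbol C → ℝ} (hp : ∀ x, 0 ≤ p x) (W : Finset (Fin C)) :
    hiddenEntropy p W = entropy p - entropy (marginal p W) := by
  have hinj : Function.Injective fun x : Symbol C => (restrict W x, restrict Wᶜ x) := by
    intro x y h
    funext i
    by_cases hi : i ∈ W
    · exact congrFun (congrArg Prod.fst h) ⟨i, hi⟩
    · exact congrFun (congrArg Prod.snd h) ⟨i, by simpa using hi⟩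
  rw [hiddenEntropy, condEntropy_eq (push_nonneg _ hp), entropy_push_of_injective hinj, push_push]
  rfl

/-! ### A single-letter bound on block equivocation -/

section SingleLetter

variable {α β : Type*} [Fintype α] [DecidableEq α] [Fintype β] [DecidableEq β] {n : ℕ}

/-- The distribution of a uniformly chosen column of a block with distribution `P`. -/
noncomputable def avgColumn (P : (Fin n → α) → ℝ) (a : α) : ℝ :=
  (∑ t, push (fun x => x t) P a) / n

theorem sum_avgColumn_mul (hn : 1 ≤ n) (P : (Fin n → α) → ℝ) (g : α → ℝ) :
    n * ∑ a, avgColumn P a * g a = ∑ x, P x * ∑ t, g (x t) := by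
  have hn' : (n : ℝ) ≠ 0 := by positivity
  have h : ∀ a, avgColumn P a * g a = (∑ t, push (fun x => x t) P a * g a) / n := fun a => by
    rw [avgColumn, ← Finset.sum_mul]; ring
  simp only [h]
  rw [← Finset.sum_div, mul_div_cancel₀ _ hn', Finset.sum_comm]
  simp only [sum_push_mul (fun x : Fin n → α => x _) P g, Finset.mul_sum]
  rw [Finset.sum_comm]

theorem avgColumn_mem_stdSimplex (hn : 1 ≤ n) {P : (Fin n → α) → ℝ}
    (hP : P ∈ stdSimplex ℝ (Fin n → α)) : avgColumn P ∈ stdSimplex ℝ α := by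
  refine ⟨fun a => div_nonneg (Finset.sum_nonneg fun t _ => push_nonneg _ hP.1 a) (by positivity),
    ?_⟩
  have hn' : (n : ℝ) ≠ 0 := by positivity
  have := sum_avgColumn_mul hn P fun _ => 1
  simp only [mul_one, Finset.sum_const, Finset.card_univ, Fintype.card_fin, nsmul_eq_mul,
    ← Finset.sum_mul, hP.2, one_mul] at this
  exact mul_left_cancel₀ hn' (this.trans (mul_one _).symm)

theorem avgColumn_pos {P : (Fin n → α) → ℝ} (hP : ∀ x, 0 ≤ P x) {x : Fin n → α}
    (hx : 0 < P x) (t : Fin n) : 0 < avgColumn P (x t) := by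
  have hn : 0 < n := t.pos
  refine div_pos ?_ (by positivity)
  exact (hx.trans_le (le_push (fun x : Fin n → α => x t) hP x)).trans_le
    (Finset.single_le_sum (f := fun s => push (fun z : Fin n → α => z s) P (x t))
      (fun s _ => push_nonneg _ hP _) (Finset.mem_univ t))

omit [DecidableEq α] in
/-- The kernel that redraws each column from its conditional law given its image under `f`
turns a distribution of images into a (sub)distribution of blocks. -/
theorem sum_push_mul_prod_le (f : α → β) {P : (Fin n → α) → ℝ}
    (hP : P ∈ stdSimplex ℝ (Fin n → α)) {q : α → ℝ} (hq : ∀ a, 0 ≤ q a) :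
    ∑ x : Fin n → α, push (fun (x : Fin n → α) t => f (x t)) P (fun t => f (x t))
      * ∏ t, (q (x t) / push f q (f (x t))) ≤ 1 := by
  set F : (Fin n → α) → (Fin n → β) := fun x t => f (x t) with hF
  have hy : ∀ y : Fin n → β,
      ∑ x : Fin n → α, (if F x = y then ∏ t, (q (x t) / push f q (f (x t))) else 0) ≤ 1 := by
    intro y
    have h1 : ∀ x : Fin n → α, (if F x = y then ∏ t, (q (x t) / push f q (f (x t))) else 0)
        = ∏ t, (if f (x t) = y t then q (x t) / push f q (y t) else 0) := by
      intro x
      split_ifs with h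
      · subst h; simp [hF]
      · obtain ⟨t, ht⟩ := Function.ne_iff.1 h
        exact (Finset.prod_eq_zero (Finset.mem_univ t) (if_neg ht)).symm
    simp only [h1]
    rw [sum_prod_pi fun t a => if f a = y t then q a / push f q (y t) else 0]
    refine Finset.prod_le_one (fun t _ => Finset.sum_nonneg fun a _ => ?_) fun t _ => ?_
    · split_ifs
      · exact div_nonneg (hq a) (push_nonneg f hq _)
      · exact le_rfl
    · have : ∀ a, (if f a = y t then q a / push f q (y t) else 0)
          = (if f a = y t then q a else 0) / push f q (y t) := fun a => by split_ifs <;> simp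
      simp only [this]
      rw [← Finset.sum_div]
      exact div_self_le_one _
  calc _ = ∑ x, ∑ y, push F P y *
        (if F x = y then ∏ t, (q (x t) / push f q (f (x t))) else 0) := by
        refine Finset.sum_congr rfl fun x _ => ?_
        simp [mul_ite, hF]
    _ = ∑ y, push F P y *
        ∑ x, (if F x = y then ∏ t, (q (x t) / push f q (f (x t))) else 0) := by
        rw [Finset.sum_comm]; simp only [Finset.mul_sum]
    _ ≤ ∑ y, push F P y * 1 :=
        Finset.sum_le_sum fun y _ => mul_le_mul_of_nonneg_left (hy y) (push_nonneg F hP.1 y)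
    _ = 1 := by simp [sum_push, hP.2]

/-- The core of the converse. `E` is the part of `P` on which the receiver succeeds; it is at most
a fraction `B` of what the observation `f (x t)`, `t < n`, leaves possible. The success
probability times `log (1 / B)` is then at most `n` times the conditional entropy of the average
column given its observation, up to a term that vanishes with the error probability. -/
theorem success_mul_log_le (hn : 1 ≤ n) (f : α → β) {P E : (Fin n → α) → ℝ}
    (hP : P ∈ stdSimplex ℝ (Fin n → α)) (hE0 : ∀ x, 0 ≤ E x) (hEP : ∀ x, E x ≤ P x) {B : ℝ}
    (hB : 0 < B)
    (hEB : ∀ x, 0 < E x → E x ≤ B * push (fun (x : Fin n → α) t => f (x t)) P (fun t => f (x t))) :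
    (∑ x, E x) * -Real.logb 2 B - (1 - ∑ x, E x) / Real.log 2
      ≤ n * (entropy (avgColumn P) - entropy (push f (avgColumn P))) := by
  set q := avgColumn P with hq
  have hqs : q ∈ stdSimplex ℝ α := avgColumn_mem_stdSimplex hn hP
  set F : (Fin n → α) → (Fin n → β) := fun x t => f (x t) with hF
  set g : α → ℝ := fun a => Real.log (push f q (f a)) - Real.log (q a) with hg
  set Q : (Fin n → α) → ℝ := fun x => push F P (F x) * ∏ t, (q (x t) / push f q (f (x t)))
    with hQ
  have hg0 : ∀ a, 0 < q a → 0 ≤ g a := fun a ha =>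
    sub_nonneg.2 (Real.log_le_log ha (le_push f hqs.1 a))
  -- This is `log y ≤ y - 1` at `y = Q x / E x`, where `E x` is bounded above by `hEB`.
  have hstep : ∀ x, E x * (-Real.log B - ∑ t, g (x t)) ≤ Q x - E x := by
    intro x
    have hK0 : 0 ≤ ∏ t, (q (x t) / push f q (f (x t))) :=
      Finset.prod_nonneg fun t _ => div_nonneg (hqs.1 _) (push_nonneg f hqs.1 _)
    rcases (hE0 x).eq_or_lt with h | h
    · rw [← h, zero_mul, sub_zero]; exact mul_nonneg (push_nonneg F hP.1 (F x)) hK0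
    · have hPx : 0 < P x := h.trans_le (hEP x)
      have hqx : ∀ t, 0 < q (x t) := avgColumn_pos hP.1 hPx
      have hfx : ∀ t, 0 < push f q (f (x t)) := fun t => (hqx t).trans_le (le_push f hqs.1 _)
      have hFx : 0 < push F P (F x) := hPx.trans_le (le_push F hP.1 x)
      have hKpos : 0 < ∏ t, (q (x t) / push f q (f (x t))) :=
        Finset.prod_pos fun t _ => div_pos (hqx t) (hfx t)
      have hlogK : Real.log (∏ t, (q (x t) / push f q (f (x t)))) = -∑ t, g (x t) := by
        rw [Real.log_prod fun t _ => (div_pos (hqx t) (hfx t)).ne', ← Finset.sum_neg_distrib]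
        refine Finset.sum_congr rfl fun t _ => ?_
        rw [Real.log_div (hqx t).ne' (hfx t).ne', hg]; ring
      have hlogQ : Real.log (Q x) = Real.log (push F P (F x)) - ∑ t, g (x t) := by
        rw [hQ]; dsimp only
        rw [Real.log_mul hFx.ne' hKpos.ne', hlogK]; ring
      have hlogE : Real.log (E x) ≤ Real.log B + Real.log (push F P (F x)) := by
        rw [← Real.log_mul hB.ne' hFx.ne']
        exact Real.log_le_log h (hEB x h)
      have hQpos : 0 < Q x := mul_pos hFx hKpos
      have hlog := Real.log_le_sub_one_of_pos (div_pos hQpos h)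
      rw [Real.log_div hQpos.ne' h.ne'] at hlog
      calc E x * (-Real.log B - ∑ t, g (x t)) ≤ E x * (Q x / E x - 1) :=
            mul_le_mul_of_nonneg_left (by linarith) h.le
        _ = Q x - E x := by field_simp
  have hsum := Finset.sum_le_sum fun x (_ : x ∈ Finset.univ) => hstep x
  have hQ1 : ∑ x, Q x ≤ 1 := sum_push_mul_prod_le f hP hqs.1
  have hEg : ∑ x, E x * ∑ t, g (x t) ≤ n * ∑ a, q a * g a := by
    rw [hq, sum_avgColumn_mul hn]
    refine Finset.sum_le_sum fun x _ => ?_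
    rcases (hP.1 x).eq_or_lt with h | h
    · have : E x = 0 := le_antisymm (h ▸ hEP x) (hE0 x)
      simp [this, ← h]
    · exact mul_le_mul_of_nonneg_right (hEP x)
        (Finset.sum_nonneg fun t _ => hg0 _ (avgColumn_pos hP.1 h t))
  have hent : entropy q - entropy (push f q) = (∑ a, q a * g a) / Real.log 2 := by
    rw [entropy_sub_entropy_push, Finset.sum_div]
    refine Finset.sum_congr rfl fun a _ => ?_
    simp only [hg, Real.logb]; ring
  have hl2 : 0 < Real.log 2 := Real.log_pos one_lt_two
  simp only [mul_sub, Finset.sum_sub_distrib, ← Finset.sum_mul] at hsum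
  rw [hent, Real.logb, ← mul_div_assoc, ← neg_div, ← mul_div_assoc, ← sub_div,
    div_le_div_iff_of_pos_right hl2]
  linarith

end SingleLetter

/-! ### The converse -/

section ActiveProb

variable {k l : ℕ}

theorem activeProb_nonneg (E : Bits k → Bits l → Prop) [∀ m s, Decidable (E m s)] :
    0 ≤ activeProb E :=
  Finset.sum_nonneg fun m _ => Finset.sum_nonneg fun s _ => by split_ifs <;> positivity

theorem activeProb_mono {E E' : Bits k → Bits l → Prop} [∀ m s, Decidable (E m s)]
    [∀ m s, Decidable (E' m s)] (h : ∀ m s, E m s → E' m s) : activeProb E ≤ activeProb E' := by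
  refine Finset.sum_le_sum fun m _ => Finset.sum_le_sum fun s _ => ?_
  by_cases hE : E m s
  · rw [if_pos hE, if_pos (h m s hE)]
  · rw [if_neg hE]; split_ifs <;> positivity

theorem activeProb_univ : activeProb (fun (_ : Bits k) (_ : Bits l) => True) = 1 := by
  simp [activeProb]
  field_simp

theorem activeProb_message (m : Bits k) :
    activeProb (fun (m' : Bits k) (_ : Bits l) => m' = m) = 1 / 2 ^ k := by
  simp only [activeProb]
  rw [Finset.sum_eq_single m (fun m' _ h => by simp [h]) (by simp)]
  simp
  field_simp

theorem activeProb_add_not (E : Bits k → Bits l → Prop) [∀ m s, Decidable (E m s)]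
    [∀ m s, Decidable (¬ E m s)] : activeProb E + activeProb (fun m s => ¬ E m s) = 1 := by
  rw [← activeProb_univ (k := k) (l := l)]
  simp only [activeProb, ← Finset.sum_add_distrib]
  refine Finset.sum_congr rfl fun m _ => Finset.sum_congr rfl fun s _ => ?_
  by_cases h : E m s <;> simp [h]

/-- Law of total probability. -/
theorem sum_activeProb {γ : Type*} [Fintype γ] [DecidableEq γ] (g : Bits k → Bits l → γ)
    (E : γ → Bits k → Bits l → Prop) [∀ x m s, Decidable (E x m s)] :
    ∑ x, activeProb (fun m s => E x m s ∧ g m s = x) = activeProb fun m s => E (g m s) m s := by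
  simp only [activeProb]
  rw [Finset.sum_comm]
  refine Finset.sum_congr rfl fun m _ => ?_
  rw [Finset.sum_comm]
  refine Finset.sum_congr rfl fun s _ => ?_
  rw [Finset.sum_eq_single (g m s) (fun x _ h => by simp [h.symm]) (by simp)]
  simp

end ActiveProb

namespace Scheme

variable {C n k l : ℕ} (S : Scheme C n k l)

theorem induced_mem_stdSimplex : S.induced ∈ stdSimplex ℝ (Codeword C n) := by
  refine ⟨fun x => activeProb_nonneg _, ?_⟩
  have := sum_activeProb S.enc fun _ _ _ => True
  simpa [activeProb_univ, induced] using this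

theorem push_induced {β : Type*} [Fintype β] [DecidableEq β] (f : Codeword C n → β) (y : β) :
    push f S.induced y = activeProb fun m s => f (S.enc m s) = y := by
  have := sum_activeProb S.enc fun x _ _ => f x = y
  rw [← this, push]
  refine Finset.sum_congr rfl fun x _ => ?_
  by_cases h : f x = y <;> simp [h, induced, activeProb]

/-- A reliable and hidable scheme has at most as many message bits as the letters of the block
can hide from an observer of the links in `W`. -/
theorem message_bits_le {𝒲 : Finset (Finset (Fin C))} {pinn : Symbol C → ℝ}
    (hpinn : ∀ x, 0 ≤ pinn x) {δ : ℝ} (hδ : 0 ≤ δ) (hn : 1 ≤ n) (hrel : S.Reliable pinn δ)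
    (hhid : S.Hidable 𝒲 δ) {W : Finset (Fin C)} (hW : W ∈ 𝒲) :
    (1 - δ) * k - (Real.logb 2 (1 + δ) + δ / Real.log 2) ≤
      n * (entropy (avgColumn S.induced) - entropy (marginal (avgColumn S.induced) W)) := by
  set E : Codeword C n → ℝ := fun x => activeProb fun m s => S.decM x = m ∧ S.enc m s = x with hE
  have hEsum : ∑ x, E x = 1 - activeProb fun m s => S.decM (S.enc m s) ≠ m := by
    rw [eq_sub_iff_add_eq, hE, sum_activeProb S.enc fun x m _ => S.decM x = m]
    exact activeProb_add_not _
  have hE1 : ∑ x, E x ≤ 1 := by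
    rw [hEsum]; linarith [activeProb_nonneg fun m s => S.decM (S.enc m s) ≠ m]
  have hEδ : 1 - δ ≤ ∑ x, E x := by
    have h1 : 0 ≤ ∑ x, if S.decT x = true then innocent pinn n x else 0 :=
      Finset.sum_nonneg fun x _ => by
        split_ifs
        · exact Finset.prod_nonneg fun t _ => hpinn _
        · exact le_rfl
    have h2 := activeProb_nonneg fun m s => S.decT (S.enc m s) = false
    rw [Reliable] at hrel
    rw [hEsum]; linarith
  have hB : (0 : ℝ) < (1 + δ) * (1 / 2 ^ k) := by positivity
  have key := success_mul_log_le hn (restrict W) S.induced_mem_stdSimplex (E := E)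
    (fun x => activeProb_nonneg _) (fun x => activeProb_mono fun m s h => h.2) hB (by
      intro x hx
      change E x ≤ _ * push (observe W) S.induced (observe W x)
      rw [S.push_induced]
      have hle : E x ≤ activeProb fun m s => m = S.decM x ∧ observe W (S.enc m s) = observe W x :=
        activeProb_mono fun m s h => ⟨h.1.symm, by rw [h.2]⟩
      have hpos : 0 < activeProb fun m s => observe W (S.enc m s) = observe W x :=
        hx.trans_le (hle.trans (activeProb_mono fun m s h => h.2))
      have hh := (hhid (S.decM x) W hW (observe W x) hpos).2
      rw [activeProb_message, div_le_iff₀ (by positivity), div_le_iff₀ hpos] at hh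
      exact hle.trans hh)
  have hlogB : -Real.logb 2 ((1 + δ) * (1 / 2 ^ k)) = k - Real.logb 2 (1 + δ) := by
    rw [Real.logb_mul (by positivity) (by positivity), one_div, Real.logb_inv, Real.logb_pow,
      Real.logb_self_eq_one one_lt_two]
    ring
  rw [hlogB] at key
  refine le_trans ?_ key
  have hlog0 : 0 ≤ Real.logb 2 (1 + δ) := Real.logb_nonneg one_lt_two (by linarith)
  have h1 : (1 - ∑ x, E x) / Real.log 2 ≤ δ / Real.log 2 :=
    div_le_div_of_nonneg_right (by linarith) (Real.log_pos one_lt_two).le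
  have h2 : (1 - δ) * k ≤ (∑ x, E x) * k := mul_le_mul_of_nonneg_right hEδ (Nat.cast_nonneg k)
  have h3 : (∑ x, E x) * Real.logb 2 (1 + δ) ≤ Real.logb 2 (1 + δ) :=
    mul_le_of_le_one_left hlog0 hE1
  linarith

end Scheme

section Deniability

variable {C n : ℕ}

theorem innocent_mem_stdSimplex {p : Symbol C → ℝ} (hp : p ∈ stdSimplex ℝ (Symbol C)) :
    innocent p n ∈ stdSimplex ℝ (Codeword C n) := by
  refine ⟨fun x => Finset.prod_nonneg fun t _ => hp.1 _, ?_⟩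
  unfold innocent
  rw [sum_prod_pi fun _ a => p a]
  simp [hp.2]

/-- The observed rows of a matrix with i.i.d. columns have i.i.d. columns with the marginal law. -/
theorem push_observe_innocent (p : Symbol C → ℝ) (W : Finset (Fin C)) (y : Fin n → W → Bool) :
    push (observe W) (innocent p n) y = ∏ t, marginal p W (y t) := by
  unfold marginal push innocent
  rw [← sum_prod_pi fun t a => if restrict W a = y t then p a else 0]
  refine Finset.sum_congr rfl fun x _ => ?_
  split_ifs with h
  · subst h; simp [observe]
  · obtain ⟨t, ht⟩ := Function.ne_iff.1 h
    exact (Finset.prod_eq_zero (Finset.mem_univ t) (if_neg ht)).symm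

theorem push_column_innocent {p : Symbol C → ℝ} (hp : p ∈ stdSimplex ℝ (Symbol C)) (t : Fin n) :
    push (fun x => x t) (innocent p n) = p := by
  funext a
  have h : ∀ x : Codeword C n, (if x t = a then innocent p n x else 0)
      = ∏ s, if s = t then (if x s = a then p (x s) else 0) else p (x s) := by
    intro x
    rw [innocent]
    split_ifs with h
    · refine Finset.prod_congr rfl fun s _ => ?_
      by_cases hs : s = t
      · subst hs; simp [h]
      · simp [hs]
    · exact (Finset.prod_eq_zero (Finset.mem_univ t) (by simp [h])).symm
  rw [push]
  simp only [h]
  rw [sum_prod_pi fun s b => if s = t then (if b = a then p b else 0) else p b]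
  have : ∀ s, (∑ b, if s = t then (if b = a then p b else 0) else p b)
      = if s = t then p a else 1 := by
    intro s
    split_ifs
    · simp
    · exact hp.2
  simp [this]

theorem abs_push_sub_push_le {α β : Type*} [Fintype α] [DecidableEq β] (f : α → β)
    (p q : α → ℝ) (b : β) : |push f p b - push f q b| ≤ 2 * tvDist p q := by
  rw [push, push, ← Finset.sum_sub_distrib, tvDist, ← mul_assoc, mul_one_div_cancel two_ne_zero,
    one_mul]
  refine (Finset.abs_sum_le_sum_abs _ _).trans (Finset.sum_le_sum fun a _ => ?_)
  split_ifs <;> simp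

/-- For a deniable scheme, the marginals of the average column are close to the innocent ones. -/
theorem abs_marginal_avgColumn_sub_le (hn : 1 ≤ n) {pinn : Symbol C → ℝ}
    (hpinn : pinn ∈ stdSimplex ℝ (Symbol C)) (P : Codeword C n → ℝ) {W : Finset (Fin C)} {δ : ℝ}
    (h : tvDist (push (observe W) (innocent pinn n)) (push (observe W) P) ≤ δ) (b : W → Bool) :
    |marginal (avgColumn P) W b - marginal pinn W b| ≤ 2 * δ := by
  have hn' : (0 : ℝ) < n := by positivity
  have hcol : ∀ Q : Codeword C n → ℝ, ∀ t : Fin n,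
      push (fun y : Fin n → W → Bool => y t) (push (observe W) Q) b
        = push (restrict W) (push (fun x => x t) Q) b := fun Q t => by
    rw [push_push, push_push]; rfl
  have hm : n * (marginal (avgColumn P) W b - marginal pinn W b) = ∑ t : Fin n,
      (push (fun y : Fin n → W → Bool => y t) (push (observe W) P) b
        - push (fun y : Fin n → W → Bool => y t) (push (observe W) (innocent pinn n)) b) := by
    simp only [hcol, push_column_innocent hpinn, Finset.sum_sub_distrib, Finset.sum_const,
      Finset.card_univ, Fintype.card_fin, nsmul_eq_mul, mul_sub]
    have := sum_avgColumn_mul hn P fun a => if restrict W a = b then 1 else 0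
    simp only [mul_ite, mul_one, mul_zero] at this
    congr 1
    refine this.trans ?_
    have h2 : ∀ t : Fin n, push (restrict W) (push (fun x => x t) P) b
        = ∑ x, P x * if restrict W (x t) = b then 1 else 0 := fun t => by
      rw [push_push]; simp [push]
    simp only [h2]
    rw [Finset.sum_comm]
    simp only [Finset.mul_sum]
  have h2 : ∀ t : Fin n, |push (fun y : Fin n → W → Bool => y t) (push (observe W) P) b
        - push (fun y : Fin n → W → Bool => y t) (push (observe W) (innocent pinn n)) b| ≤ 2 * δ :=
    fun t => by
      rw [abs_sub_comm]
      exact (abs_push_sub_push_le _ _ _ _).trans (by linarith)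
  have h3 := (Finset.abs_sum_le_sum_abs _ _).trans
    (Finset.sum_le_sum fun t (_ : t ∈ Finset.univ) => h2 t)
  rw [← hm, abs_mul, abs_of_pos hn', Finset.sum_const, Finset.card_univ, Fintype.card_fin,
    nsmul_eq_mul] at h3
  exact le_of_mul_le_mul_left h3 hn'

end Deniability

section Converse

variable {C : ℕ} {𝒲 : Finset (Finset (Fin C))} {pinn : Symbol C → ℝ}

theorem self_mem_matching (hpinn : pinn ∈ stdSimplex ℝ (Symbol C)) : pinn ∈ matching 𝒲 pinn :=
  ⟨hpinn, fun _ _ => rfl⟩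

theorem entropy_sub_entropy_marginal_nonneg {p : Symbol C → ℝ} (hp : ∀ x, 0 ≤ p x)
    (W : Finset (Fin C)) : 0 ≤ entropy p - entropy (marginal p W) := by
  rw [marginal, entropy_sub_entropy_push]
  refine Finset.sum_nonneg fun a _ => ?_
  rcases (hp a).eq_or_lt with h | h
  · simp [← h]
  · exact mul_nonneg h.le
      (sub_nonneg.2 (Real.logb_le_logb_of_le one_lt_two h (le_push _ hp a)))

/-- The converse: schemes with vanishing tolerances have average columns that accumulate, by
compactness of the simplex, at a matching distribution. -/
theorem exists_tolerance_of_lt (h𝒲 : 𝒲.Nonempty) (hpinn : pinn ∈ stdSimplex ℝ (Symbol C))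
    {R : ℝ} (hR : ∀ p ∈ matching 𝒲 pinn,
      (𝒲.inf' h𝒲 fun W => entropy p - entropy (marginal p W)) < R) :
    ∃ δ > 0, ∀ n k l : ℕ, 1 ≤ n → n * R ≤ k → ∀ S : Scheme C n k l,
      ¬ (S.Reliable pinn δ ∧ S.Deniable 𝒲 pinn δ ∧ S.Hidable 𝒲 δ) := by
  by_contra! hcon
  have hstep : ∀ j : ℕ, ∃ p ∈ stdSimplex ℝ (Symbol C), ∀ W ∈ 𝒲,
      ((1 - 1 / ((j : ℝ) + 1)) * R
        - (Real.logb 2 (1 + 1 / ((j : ℝ) + 1)) + 1 / ((j : ℝ) + 1) / Real.log 2)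
          ≤ entropy p - entropy (marginal p W)) ∧
      ∀ b, |marginal p W b - marginal pinn W b| ≤ 2 * (1 / ((j : ℝ) + 1)) := by
    intro j
    have hδ : (0 : ℝ) < 1 / ((j : ℝ) + 1) := by positivity
    have hδ1 : 1 / ((j : ℝ) + 1) ≤ 1 := by
      rw [div_le_one (by positivity)]; linarith [Nat.cast_nonneg (α := ℝ) j]
    set δ := 1 / ((j : ℝ) + 1)
    obtain ⟨n, k, l, hn, hk, S, hrel, hden, hhid⟩ := hcon δ hδ
    refine ⟨avgColumn S.induced, avgColumn_mem_stdSimplex hn S.induced_mem_stdSimplex,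
      fun W hW => ⟨?_, fun b => abs_marginal_avgColumn_sub_le hn hpinn _ (hden W hW).le b⟩⟩
    have hmb := S.message_bits_le hpinn.1 hδ.le hn hrel hhid hW
    have hn' : (1 : ℝ) ≤ n := by exact_mod_cast hn
    have hc : 0 ≤ Real.logb 2 (1 + δ) + δ / Real.log 2 :=
      add_nonneg (Real.logb_nonneg one_lt_two (by linarith))
        (div_nonneg hδ.le (Real.log_pos one_lt_two).le)
    have h1 := mul_le_mul_of_nonneg_left hk (sub_nonneg.2 hδ1)
    have h2 := mul_le_mul_of_nonneg_right hn' hc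
    refine le_of_mul_le_mul_left ?_ (by linarith : (0 : ℝ) < n)
    linarith
  choose p hp hpW using hstep
  obtain ⟨q, hq, φ, hφ, hlim⟩ := (isCompact_stdSimplex ℝ (Symbol C)).tendsto_subseq hp
  have hδ : Filter.Tendsto (fun j => 1 / ((φ j : ℝ) + 1)) Filter.atTop (nhds 0) :=
    tendsto_one_div_add_atTop_nhds_zero_nat.comp hφ.tendsto_atTop
  have hmarg : ∀ W, Filter.Tendsto (fun j => marginal (p (φ j)) W) Filter.atTop
      (nhds (marginal q W)) := fun W =>
    ((continuous_push (restrict W)).tendsto q).comp hlim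
  have hqm : q ∈ matching 𝒲 pinn := by
    refine ⟨hq, fun W hW => funext fun b => ?_⟩
    have h1 : Filter.Tendsto (fun j => |marginal (p (φ j)) W b - marginal pinn W b|) Filter.atTop
        (nhds |marginal q W b - marginal pinn W b|) :=
      (((tendsto_pi_nhds.1 (hmarg W)) b).sub_const _).abs
    have h2 := le_of_tendsto_of_tendsto' h1 (hδ.const_mul 2) fun j => (hpW (φ j) W hW).2 b
    rw [mul_zero] at h2
    exact sub_eq_zero.1 (abs_nonpos_iff.1 h2)
  refine (hR q hqm).not_ge ((Finset.le_inf'_iff _ _).2 fun W hW => ?_)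
  have h1 : Filter.Tendsto (fun j => entropy (p (φ j)) - entropy (marginal (p (φ j)) W))
      Filter.atTop (nhds (entropy q - entropy (marginal q W))) :=
    ((continuous_entropy.tendsto q).comp hlim).sub
      ((continuous_entropy.tendsto _).comp (hmarg W))
  have hcont : ContinuousAt
      (fun δ : ℝ => (1 - δ) * R - (Real.logb 2 (1 + δ) + δ / Real.log 2)) 0 := by
    unfold Real.logb
    have : ContinuousAt (fun δ : ℝ => Real.log (1 + δ)) 0 :=
      ContinuousAt.log (by fun_prop) (by norm_num)
    fun_prop
  have h2 := hcont.tendsto.comp hδ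
  simp only [sub_zero, one_mul, add_zero, Real.logb_one, zero_div] at h2
  exact le_of_tendsto_of_tendsto' h2 h1 fun j => (hpW (φ j) W hW).1

end Converse

/-! ### Random codebooks -/

section RandomCode

variable {ι 𝒳 : Type*} [Fintype ι] [DecidableEq ι] [Fintype 𝒳] {Q : 𝒳 → ℝ}

theorem sum_codebook (hQ : Q ∈ stdSimplex ℝ 𝒳) : ∑ c : ι → 𝒳, ∏ i, Q (c i) = 1 := by
  rw [sum_prod_pi fun _ x => Q x]
  simp [hQ.2]

theorem sum_codebook_mul (hQ : Q ∈ stdSimplex ℝ 𝒳) (i : ι) (g : 𝒳 → ℝ) :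
    ∑ c : ι → 𝒳, (∏ j, Q (c j)) * g (c i) = ∑ x, Q x * g x := by
  have h : ∀ c : ι → 𝒳, (∏ j, Q (c j)) * g (c i)
      = ∏ j, Q (c j) * if j = i then g (c j) else 1 := fun c => by
    rw [Finset.prod_mul_distrib]; simp
  simp only [h]
  rw [sum_prod_pi fun j x => Q x * if j = i then g x else 1,
    Finset.prod_eq_single i (fun j _ hj => by simp [hj, hQ.2]) (by simp)]
  simp

/-- Two different codewords of a random codebook coincide with probability `∑ x, Q x ^ 2`. -/
theorem sum_codebook_collision [DecidableEq 𝒳] (hQ : Q ∈ stdSimplex ℝ 𝒳) {i j : ι} (hij : i ≠ j) :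
    ∑ c : ι → 𝒳, (∏ a, Q (c a)) * (if c i = c j then 1 else 0) = ∑ x, Q x * Q x := by
  have h : ∀ c : ι → 𝒳, (∏ a, Q (c a)) * (if c i = c j then 1 else 0)
      = ∑ x, ∏ a, Q (c a) * if a = i ∨ a = j then (if c a = x then 1 else 0) else 1 := by
    intro c
    simp only [Finset.prod_mul_distrib, ← Finset.mul_sum]
    congr 1
    have hx : ∀ x, (∏ a, if a = i ∨ a = j then (if c a = x then (1 : ℝ) else 0) else 1)
        = if c i = x then (if c i = c j then 1 else 0) else 0 := by
      intro x
      by_cases hi : c i = x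
      · by_cases hj : c j = x
        · rw [if_pos hi, if_pos (hi.trans hj.symm)]
          refine Finset.prod_eq_one fun a _ => ?_
          split_ifs with h1 h2
          · rfl
          · rcases h1 with rfl | rfl <;> contradiction
          · rfl
        · rw [if_pos hi, if_neg fun h => hj (h.symm.trans hi)]
          exact Finset.prod_eq_zero (Finset.mem_univ j) (by simp [hj])
      · rw [if_neg hi]
        exact Finset.prod_eq_zero (Finset.mem_univ i) (by simp [hi])
    simp [hx]
  simp only [h]
  rw [Finset.sum_comm]
  refine Finset.sum_congr rfl fun x _ => ?_
  rw [sum_prod_pi fun a z => Q z * if a = i ∨ a = j then (if z = x then 1 else 0) else 1]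
  rw [← Finset.mul_prod_erase _ _ (Finset.mem_univ i),
    ← Finset.mul_prod_erase _ _ (Finset.mem_erase.2 ⟨hij.symm, Finset.mem_univ j⟩),
    Finset.prod_eq_one fun a ha => ?_]
  · simp
  · simp only [Finset.mem_erase] at ha
    simp [ha.1, ha.2.1, hQ.2]

/-- The moment generating function of the number of codewords with indices in `J` that fall into
`A`. -/
theorem sum_codebook_exp_le [DecidableEq 𝒳] (hQ : Q ∈ stdSimplex ℝ 𝒳) (J : Finset ι)
    (A : Finset 𝒳) {b : ℝ} (hb : |b| ≤ 1) :
    ∑ c : ι → 𝒳, (∏ i, Q (c i)) * Real.exp (b * ∑ i ∈ J, if c i ∈ A then 1 else 0)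
      ≤ Real.exp (J.card * (∑ x ∈ A, Q x) * (b + b ^ 2)) := by
  set q := ∑ x ∈ A, Q x with hq
  have hq0 : 0 ≤ q := Finset.sum_nonneg fun x _ => hQ.1 x
  have h : ∀ c : ι → 𝒳,
      (∏ i, Q (c i)) * Real.exp (b * ∑ i ∈ J, if c i ∈ A then 1 else 0)
        = ∏ i, Q (c i) * if i ∈ J then Real.exp (b * if c i ∈ A then 1 else 0) else 1 := by
    intro c
    rw [Finset.prod_mul_distrib, Finset.mul_sum, Real.exp_sum]
    congr 1
    simp [Finset.prod_ite_mem]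
  have hin : ∑ x, Q x * Real.exp (b * if x ∈ A then 1 else 0) = 1 + q * (Real.exp b - 1) := by
    have : ∀ x, Q x * Real.exp (b * if x ∈ A then 1 else 0)
        = Q x + (if x ∈ A then Q x else 0) * (Real.exp b - 1) := fun x => by
      split_ifs <;> simp; ring
    simp only [this, Finset.sum_add_distrib, hQ.2, ← Finset.sum_mul]
    simp [hq]
  have hfac : ∀ i, ∑ x, Q x * (if i ∈ J then Real.exp (b * if x ∈ A then 1 else 0) else 1)
      = if i ∈ J then 1 + q * (Real.exp b - 1) else 1 := fun i => by
    split_ifs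
    · exact hin
    · simp [hQ.2]
  simp only [h]
  rw [sum_prod_pi fun i x =>
    Q x * if i ∈ J then Real.exp (b * if x ∈ A then 1 else 0) else 1]
  simp only [hfac]
  rw [Finset.prod_ite_mem, Finset.univ_inter, Finset.prod_const, mul_assoc, Real.exp_nat_mul]
  have hexp : Real.exp b - 1 ≤ b + b ^ 2 := by
    have := (abs_le.1 (Real.abs_exp_sub_one_sub_id_le hb)).2
    linarith
  refine pow_le_pow_left₀ ?_ ?_ _
  · rw [← hin]
    exact Finset.sum_nonneg fun x _ => mul_nonneg (hQ.1 x) (Real.exp_pos _).le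
  · calc 1 + q * (Real.exp b - 1) ≤ q * (b + b ^ 2) + 1 := by
          linarith [mul_le_mul_of_nonneg_left hexp hq0]
      _ ≤ _ := Real.add_one_le_exp _

/-- A multiplicative Chernoff bound. -/
theorem sum_codebook_deviation_le [DecidableEq 𝒳] (hQ : Q ∈ stdSimplex ℝ 𝒳) (J : Finset ι)
    (A : Finset 𝒳) {η : ℝ} (hη : 0 < η) (hη1 : η ≤ 1) :
    ∑ c : ι → 𝒳, (∏ i, Q (c i)) *
        (if |(∑ i ∈ J, if c i ∈ A then 1 else 0) - J.card * ∑ x ∈ A, Q x|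
          ≤ η * (J.card * ∑ x ∈ A, Q x) then 0 else 1)
      ≤ 2 * Real.exp (-(J.card * (∑ x ∈ A, Q x) * (η ^ 2 / 4))) := by
  set a : ℝ := J.card * ∑ x ∈ A, Q x with ha
  have hbound : ∀ N : ℝ, (if |N - a| ≤ η * a then (0 : ℝ) else 1)
      ≤ Real.exp (-(η / 2 * a + η ^ 2 / 2 * a)) * Real.exp (η / 2 * N)
        + Real.exp (η / 2 * a - η ^ 2 / 2 * a) * Real.exp (-(η / 2) * N) := by
    intro N
    rw [← Real.exp_add, ← Real.exp_add]
    split_ifs with h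
    · positivity
    · rw [not_le, lt_abs] at h
      rcases h with h | h
      · refine le_add_of_le_of_nonneg (Real.one_le_exp ?_) (Real.exp_pos _).le
        nlinarith
      · refine le_add_of_nonneg_of_le (Real.exp_pos _).le (Real.one_le_exp ?_)
        nlinarith
  have habs : |η / 2| ≤ 1 := by rw [abs_of_pos (by positivity)]; linarith
  have habs' : |-(η / 2)| ≤ 1 := by rwa [abs_neg]
  have h1 := sum_codebook_exp_le hQ J A habs
  have h2 := sum_codebook_exp_le hQ J A habs'
  rw [← ha] at h1 h2
  calc _ ≤ ∑ c : ι → 𝒳, (∏ i, Q (c i)) *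
        (Real.exp (-(η / 2 * a + η ^ 2 / 2 * a))
            * Real.exp (η / 2 * ∑ i ∈ J, if c i ∈ A then 1 else 0)
          + Real.exp (η / 2 * a - η ^ 2 / 2 * a)
            * Real.exp (-(η / 2) * ∑ i ∈ J, if c i ∈ A then 1 else 0)) :=
        Finset.sum_le_sum fun c _ =>
          mul_le_mul_of_nonneg_left (hbound _) (Finset.prod_nonneg fun i _ => hQ.1 _)
    _ = Real.exp (-(η / 2 * a + η ^ 2 / 2 * a)) * (∑ c : ι → 𝒳, (∏ i, Q (c i)) *
            Real.exp (η / 2 * ∑ i ∈ J, if c i ∈ A then 1 else 0))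
          + Real.exp (η / 2 * a - η ^ 2 / 2 * a) * (∑ c : ι → 𝒳, (∏ i, Q (c i)) *
            Real.exp (-(η / 2) * ∑ i ∈ J, if c i ∈ A then 1 else 0)) := by
        rw [Finset.mul_sum, Finset.mul_sum, ← Finset.sum_add_distrib]
        exact Finset.sum_congr rfl fun c _ => by ring
    _ ≤ Real.exp (-(η / 2 * a + η ^ 2 / 2 * a)) * Real.exp (a * (η / 2 + (η / 2) ^ 2))
          + Real.exp (η / 2 * a - η ^ 2 / 2 * a)
            * Real.exp (a * (-(η / 2) + (-(η / 2)) ^ 2)) := by gcongr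
    _ = _ := by
        rw [← Real.exp_add, ← Real.exp_add, two_mul]
        congr 2 <;> ring

/-- Random coding. There is a codebook whose words lie in the support of `Q`, in which every
message has nearly the expected number of codewords in every cell that `Q` does not neglect, and
which is seldom hit by an independent input with law `v` and has few coinciding codewords. -/
theorem exists_codebook {A B κ : Type*} [Fintype A] [DecidableEq A] [Nonempty A] [Fintype B]
    [DecidableEq B] [Nonempty B] [DecidableEq 𝒳] (hQ : Q ∈ stdSimplex ℝ 𝒳) {v : 𝒳 → ℝ}
    (hv : v ∈ stdSimplex ℝ 𝒳) (cell : κ → Finset 𝒳) (K : Finset κ) {θ b η ε : ℝ}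
    (hb : ∀ x, Q x ≤ b) (hθ : ∀ z ∈ K, θ ≤ ∑ x ∈ cell z, Q x) (hη : 0 < η) (hη1 : η ≤ 1)
    (hε : 0 < ε)
    (hsmall : 2 * (Fintype.card A * Fintype.card B * b)
      + ε * (Fintype.card A * (K.card * (2 * Real.exp (-(Fintype.card B * θ * (η ^ 2 / 4))))))
        < ε) :
    ∃ c : A × B → 𝒳, (∀ i, 0 < Q (c i)) ∧
      (∀ m, ∀ z ∈ K, |(∑ s, if c (m, s) ∈ cell z then 1 else 0)
          - Fintype.card B * ∑ x ∈ cell z, Q x| ≤ η * (Fintype.card B * ∑ x ∈ cell z, Q x)) ∧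
      (∑ i, v (c i)) + (∑ i, ∑ j, if i ≠ j ∧ c i = c j then 1 else 0)
        / (Fintype.card A * Fintype.card B) < ε := by
  set N : ℝ := Fintype.card A * Fintype.card B with hN
  have hNpos : 0 < N := by rw [hN]; exact_mod_cast Nat.mul_pos Fintype.card_pos Fintype.card_pos
  have hNcard : (Fintype.card (A × B) : ℝ) = N := by rw [Fintype.card_prod]; push_cast; rfl
  set bad : A → κ → (A × B → 𝒳) → ℝ := fun m z c =>
    if |(∑ s, if c (m, s) ∈ cell z then 1 else 0)
      - Fintype.card B * ∑ x ∈ cell z, Q x| ≤ η * (Fintype.card B * ∑ x ∈ cell z, Q x)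
    then 0 else 1 with hbad
  have hbad0 : ∀ m z c, 0 ≤ bad m z c := fun m z c => by
    simp only [hbad]; split_ifs <;> norm_num
  set w : (A × B → 𝒳) → ℝ := fun c => ∏ i, Q (c i) with hw
  have hw0 : ∀ c, 0 ≤ w c := fun c => Finset.prod_nonneg fun i _ => hQ.1 _
  set fa : (A × B → 𝒳) → ℝ := fun c => ∑ i, v (c i) with hfa
  set col : (A × B → 𝒳) → ℝ := fun c => ∑ i, ∑ j, if i ≠ j ∧ c i = c j then 1 else 0 with hcol
  have hb0 : 0 ≤ b := by
    obtain ⟨x, -, -⟩ := Finset.exists_ne_zero_of_sum_ne_zero (hQ.2.trans_ne one_ne_zero)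
    exact (hQ.1 x).trans (hb x)
  have hEfa : ∑ c, w c * fa c ≤ N * b := by
    simp only [hfa, Finset.mul_sum]
    rw [Finset.sum_comm]
    refine (Finset.sum_le_card_nsmul _ _ b fun i _ => ?_).trans_eq ?_
    · rw [sum_codebook_mul hQ]
      calc ∑ x, Q x * v x ≤ ∑ x, b * v x :=
            Finset.sum_le_sum fun x _ => mul_le_mul_of_nonneg_right (hb x) (hv.1 x)
        _ = b := by rw [← Finset.mul_sum, hv.2, mul_one]
    · rw [Finset.card_univ, nsmul_eq_mul, hNcard]
  have hEcol : ∑ c, w c * col c ≤ N * (N * b) := by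
    have hpair : ∀ i j : A × B,
        ∑ c : A × B → 𝒳, w c * (if i ≠ j ∧ c i = c j then 1 else 0) ≤ b := by
      intro i j
      by_cases hij : i = j
      · simpa [hij] using hb0
      · simp only [ne_eq, hij, not_false_eq_true, true_and]
        rw [sum_codebook_collision hQ hij]
        calc ∑ x, Q x * Q x ≤ ∑ x, b * Q x :=
              Finset.sum_le_sum fun x _ => mul_le_mul_of_nonneg_right (hb x) (hQ.1 x)
          _ = b := by rw [← Finset.mul_sum, hQ.2, mul_one]
    simp only [hcol, Finset.mul_sum]
    rw [Finset.sum_comm]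
    refine (Finset.sum_le_card_nsmul _ _ (N * b) fun i _ => ?_).trans_eq ?_
    · rw [Finset.sum_comm]
      refine (Finset.sum_le_card_nsmul _ _ b fun j _ => hpair i j).trans_eq ?_
      rw [Finset.card_univ, nsmul_eq_mul, hNcard]
    · rw [Finset.card_univ, nsmul_eq_mul, hNcard]
  have hEbad : ∀ m, ∀ z ∈ K, ∑ c, w c * bad m z c
      ≤ 2 * Real.exp (-(Fintype.card B * θ * (η ^ 2 / 4))) := by
    intro m z hz
    set J : Finset (A × B) := Finset.univ.map ⟨fun s => (m, s), Prod.mk_right_injective m⟩ with hJ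
    have hJc : J.card = Fintype.card B := by rw [hJ, Finset.card_map, Finset.card_univ]
    have h := sum_codebook_deviation_le hQ J (cell z) hη hη1
    simp only [hJc] at h
    simp only [hJ, Finset.sum_map, Function.Embedding.coeFn_mk] at h
    refine h.trans ?_
    gcongr
    exact hθ z hz
  have hEbadsum : ∑ c, w c * ∑ m, ∑ z ∈ K, bad m z c
      ≤ Fintype.card A * (K.card * (2 * Real.exp (-(Fintype.card B * θ * (η ^ 2 / 4))))) := by
    simp only [Finset.mul_sum]
    rw [Finset.sum_comm]
    refine (Finset.sum_le_card_nsmul _ _ _ fun m _ => ?_).trans_eq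
      (by rw [Finset.card_univ, nsmul_eq_mul])
    rw [Finset.sum_comm]
    exact (Finset.sum_le_card_nsmul _ _ _ fun z hz => hEbad m z hz).trans_eq (nsmul_eq_mul _ _)
  have htotal : ∑ c, w c * (fa c + col c / N + ε * ∑ m, ∑ z ∈ K, bad m z c) < ∑ c, w c * ε := by
    rw [← Finset.sum_mul, sum_codebook hQ, one_mul]
    have : ∀ c, w c * (fa c + col c / N + ε * ∑ m, ∑ z ∈ K, bad m z c)
        = w c * fa c + (w c * col c) / N + ε * (w c * ∑ m, ∑ z ∈ K, bad m z c) := fun c => by ring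
    simp only [this, Finset.sum_add_distrib]
    rw [← Finset.sum_div, ← Finset.mul_sum]
    have h1 : (∑ c, w c * col c) / N ≤ N * b := by
      rw [div_le_iff₀ hNpos]; linarith
    have h2 := mul_le_mul_of_nonneg_left hEbadsum hε.le
    linarith
  obtain ⟨c, -, hc⟩ := Finset.exists_lt_of_sum_lt htotal
  have hwc : 0 < w c := (hw0 c).lt_of_ne fun h => by simp [← h] at hc
  have hc' := lt_of_mul_lt_mul_left hc (hw0 c)
  have hsum0 : 0 ≤ ∑ m, ∑ z ∈ K, bad m z c :=
    Finset.sum_nonneg fun m _ => Finset.sum_nonneg fun z _ => hbad0 m z c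
  have hfa0 : 0 ≤ fa c := Finset.sum_nonneg fun i _ => hv.1 _
  have hcol0 : 0 ≤ col c / N := div_nonneg (Finset.sum_nonneg fun i _ =>
    Finset.sum_nonneg fun j _ => by split_ifs <;> norm_num) hNpos.le
  refine ⟨c, fun i => (hQ.1 _).lt_of_ne fun h => hwc.ne' ?_, fun m z hz => ?_, ?_⟩
  · exact Finset.prod_eq_zero (Finset.mem_univ i) h.symm
  · by_contra hcon
    have h1 : bad m z c = 1 := if_neg hcon
    have h2 : bad m z c ≤ ∑ m, ∑ z ∈ K, bad m z c :=
      (Finset.single_le_sum (f := fun z => bad m z c) (fun z _ => hbad0 m z c) hz).trans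
        (Finset.single_le_sum (f := fun m => ∑ z ∈ K, bad m z c)
          (fun m _ => Finset.sum_nonneg fun z _ => hbad0 m z c) (Finset.mem_univ m))
    rw [h1] at h2
    have := mul_le_mul_of_nonneg_left h2 hε.le
    linarith
  · have := mul_nonneg hε.le hsum0
    change fa c + col c / N < ε
    linarith

end RandomCode

/-- Pruning: discarding the cells of mass less than `θ` one after the other costs at most `θ` per
cell, and in the end every cell is empty or has mass at least `θ`. -/
theorem exists_pruned {𝒳 κ : Type*} [DecidableEq 𝒳] [DecidableEq κ] (μ : 𝒳 → ℝ)
    (cell : κ → Finset 𝒳) {θ : ℝ} (hθ : 0 ≤ θ) (K : Finset κ) (T : Finset 𝒳) :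
    ∃ G ⊆ T, (∑ x ∈ T, μ x) - K.card * θ ≤ ∑ x ∈ G, μ x ∧
      ∀ z ∈ K, G ∩ cell z = ∅ ∨ θ ≤ ∑ x ∈ G ∩ cell z, μ x := by
  induction K using Finset.strongInduction generalizing T with
  | H K ih =>
    by_cases h : ∀ z ∈ K, θ ≤ ∑ x ∈ T ∩ cell z, μ x
    · exact ⟨T, Finset.Subset.refl T, by linarith [mul_nonneg (Nat.cast_nonneg (α := ℝ) K.card) hθ],
        fun z hz => Or.inr (h z hz)⟩
    · push Not at h
      obtain ⟨z, hz, hlt⟩ := h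
      obtain ⟨G, hG, hsum, hcell⟩ := ih (K.erase z) (Finset.erase_ssubset hz) (T \ cell z)
      refine ⟨G, hG.trans Finset.sdiff_subset, ?_, fun z' hz' => ?_⟩
      · have hcard : ((K.erase z).card : ℝ) = K.card - 1 := by
          rw [Finset.card_erase_of_mem hz, Nat.cast_sub (Finset.card_pos.2 ⟨z, hz⟩), Nat.cast_one]
        have hsplit := Finset.sum_inter_add_sum_sdiff T (cell z) μ
        rw [hcard] at hsum
        linarith
      · by_cases hzz : z' = z
        · subst hzz
          refine Or.inl (Finset.disjoint_iff_inter_eq_empty.1 ?_)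
          exact Finset.disjoint_of_subset_left hG Finset.sdiff_disjoint
        · exact hcell z' (Finset.mem_erase.2 ⟨hzz, hz'⟩)

/-! ### Typical sequences -/

section Typical

open Filter Topology

variable {α : Type*} [Fintype α]

/-- An exponential bound on the upper tail of the empirical mean of i.i.d. samples. -/
theorem exists_rate_of_mean_lt {p : α → ℝ} (hp : p ∈ stdSimplex ℝ α) (g : α → ℝ) {c : ℝ}
    (hc : ∑ a, p a * g a < c) :
    ∃ ρ : ℝ, 0 ≤ ρ ∧ ρ < 1 ∧ ∀ n : ℕ,
      ∑ x : Fin n → α, (if n * c ≤ ∑ t, g (x t) then ∏ t, p (x t) else 0) ≤ ρ ^ n := by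
  set h : α → ℝ := fun a => g a - c with hh
  set d : ℝ := c - ∑ a, p a * g a with hd
  have hd0 : 0 < d := sub_pos.2 hc
  have hph : ∑ a, p a * h a = -d := by
    simp only [hh, mul_sub, Finset.sum_sub_distrib, ← Finset.sum_mul, hp.2]
    rw [hd]; ring
  obtain ⟨B, hB⟩ : ∃ B, ∀ a, |h a| ≤ B := by
    obtain ⟨B, hB⟩ := (Set.finite_range fun a => |h a|).bddAbove
    exact ⟨B, fun a => hB ⟨a, rfl⟩⟩
  have hdB : d ≤ B := by
    calc d = ∑ a, p a * -h a := by simp [Finset.sum_neg_distrib, hph]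
      _ ≤ ∑ a, p a * B := Finset.sum_le_sum fun a _ =>
          mul_le_mul_of_nonneg_left ((neg_le_abs _).trans (hB a)) (hp.1 a)
      _ = B := by rw [← Finset.sum_mul, hp.2, one_mul]
  have hB0 : 0 < B := hd0.trans_le hdB
  -- This `b` minimizes the bound `1 - b d + b² B²` on the moment generating function `ρ`.
  set b : ℝ := d / (2 * B ^ 2) with hb
  have hb0 : 0 < b := by positivity
  have hbB : b * B ≤ 1 := by
    rw [hb, div_mul_eq_mul_div, div_le_one (by positivity)]
    nlinarith
  set ρ : ℝ := ∑ a, p a * Real.exp (b * h a) with hρ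
  have hρ1 : ρ ≤ 1 - b * d + b ^ 2 * B ^ 2 := by
    have hle : ∀ a, p a * Real.exp (b * h a) ≤ p a + b * (p a * h a) + p a * (b ^ 2 * B ^ 2) := by
      intro a
      have hba : |b * h a| ≤ 1 := by
        rw [abs_mul, abs_of_pos hb0]
        exact (mul_le_mul_of_nonneg_left (hB a) hb0.le).trans hbB
      have h1 := (abs_le.1 (Real.abs_exp_sub_one_sub_id_le hba)).2
      have h2 : (h a) ^ 2 ≤ B ^ 2 := sq_le_sq' (neg_le_of_abs_le (hB a)) (le_of_abs_le (hB a))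
      have h3 : Real.exp (b * h a) ≤ 1 + b * h a + b ^ 2 * B ^ 2 := by
        nlinarith [mul_le_mul_of_nonneg_left h2 (sq_nonneg b)]
      nlinarith [mul_le_mul_of_nonneg_left h3 (hp.1 a)]
    refine (Finset.sum_le_sum fun a _ => hle a).trans_eq ?_
    rw [Finset.sum_add_distrib, Finset.sum_add_distrib, ← Finset.mul_sum, ← Finset.sum_mul, hph,
      hp.2]
    ring
  refine ⟨ρ, Finset.sum_nonneg fun a _ => mul_nonneg (hp.1 a) (Real.exp_pos _).le, ?_,
    fun n => ?_⟩
  · have h1 : b * B ^ 2 = d / 2 := by rw [hb]; field_simp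
    have h2 : b ^ 2 * B ^ 2 = b * (d / 2) := by rw [← h1]; ring
    nlinarith [mul_pos hb0 hd0]
  · have hpow : ρ ^ n = ∑ x : Fin n → α, ∏ t, p (x t) * Real.exp (b * h (x t)) := by
      rw [sum_prod_pi fun _ a => p a * Real.exp (b * h a)]
      simp [hρ]
    rw [hpow]
    refine Finset.sum_le_sum fun x _ => ?_
    have hP : 0 ≤ ∏ t, p (x t) := Finset.prod_nonneg fun t _ => hp.1 _
    rw [Finset.prod_mul_distrib, ← Real.exp_sum, ← Finset.mul_sum]
    split_ifs with hx
    · refine le_mul_of_one_le_right hP (Real.one_le_exp (mul_nonneg hb0.le ?_))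
      simp only [hh, Finset.sum_sub_distrib, Finset.sum_const, Finset.card_univ,
        Fintype.card_fin, nsmul_eq_mul]
      linarith
    · exact mul_nonneg hP (Real.exp_pos _).le

theorem prod_eq_two_rpow_sum_logb {ι : Type*} [Fintype ι] {f : ι → ℝ} (hf : ∀ i, 0 < f i) :
    ∏ i, f i = (2 : ℝ) ^ ∑ i, Real.logb 2 (f i) := by
  rw [Real.rpow_sum_of_pos two_pos]
  exact Finset.prod_congr rfl fun i _ => (Real.rpow_logb two_pos (by norm_num) (hf i)).symm

/-- The codewords of probability at most `2 ^ (-n h)` whose observations on each set of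
links in `𝒲` have probability at least `2 ^ (-n u)`, for i.i.d. columns with law `p`. -/
noncomputable def typical {C : ℕ} (𝒲 : Finset (Finset (Fin C))) (p : Symbol C → ℝ) (h u : ℝ)
    (n : ℕ) : Finset (Codeword C n) :=
  open Classical in
  Finset.univ.filter fun x => innocent p n x ≤ 2 ^ (-(n * h)) ∧
    ∀ W ∈ 𝒲, 2 ^ (-(n * u)) ≤ push (observe W) (innocent p n) (observe W x)

theorem tendsto_sum_typical {C : ℕ} {𝒲 : Finset (Finset (Fin C))} {p : Symbol C → ℝ}
    (hp : p ∈ stdSimplex ℝ (Symbol C)) {h u : ℝ} (hh : h < entropy p)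
    (hu : ∀ W ∈ 𝒲, entropy (marginal p W) < u) {ε : ℝ} (hε : 0 < ε) :
    ∀ᶠ n : ℕ in atTop, 1 - ε ≤ ∑ x ∈ typical 𝒲 p h u n, innocent p n x := by
  obtain ⟨ρ, hρ0, hρ1, hρ⟩ := exists_rate_of_mean_lt hp (fun a => Real.logb 2 (p a)) (c := -h)
    (by rw [entropy] at hh; linarith)
  have hW : ∀ W : Finset (Fin C), ∃ σ : ℝ, 0 ≤ σ ∧ σ < 1 ∧ (W ∈ 𝒲 → ∀ n : ℕ,
      ∑ x : Fin n → Symbol C, (if n * u ≤ ∑ t, -Real.logb 2 (marginal p W (restrict W (x t)))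
        then ∏ t, p (x t) else 0) ≤ σ ^ n) := by
    intro W
    by_cases hW : W ∈ 𝒲
    · obtain ⟨σ, h0, h1, h2⟩ := exists_rate_of_mean_lt hp
        (fun a => -Real.logb 2 (marginal p W (restrict W a))) (c := u) (by
          have := hu W hW
          rw [entropy_eq] at this
          rwa [marginal, sum_push_mul (restrict W) p
            fun b => -Real.logb 2 (push (restrict W) p b)] at this)
      exact ⟨σ, h0, h1, fun _ => h2⟩
    · exact ⟨0, le_rfl, one_pos, fun h => absurd h hW⟩
  choose σ hσ0 hσ1 hσ using hW
  have hlim : Tendsto (fun n : ℕ => ρ ^ n + ∑ W ∈ 𝒲, σ W ^ n) atTop (𝓝 0) := by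
    have := (tendsto_pow_atTop_nhds_zero_of_lt_one hρ0 hρ1).add
      (tendsto_finsetSum 𝒲 fun W _ => tendsto_pow_atTop_nhds_zero_of_lt_one (hσ0 W) (hσ1 W))
    simpa using this
  filter_upwards [hlim.eventually_lt_const hε] with n hn
  have hpoint : ∀ x : Codeword C n, innocent p n x
      ≤ (if x ∈ typical 𝒲 p h u n then innocent p n x else 0)
        + ((if n * -h ≤ ∑ t, Real.logb 2 (p (x t)) then ∏ t, p (x t) else 0)
        + ∑ W ∈ 𝒲, if n * u ≤ ∑ t, -Real.logb 2 (marginal p W (restrict W (x t)))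
          then ∏ t, p (x t) else 0) := by
    intro x
    have hx0 : 0 ≤ innocent p n x := Finset.prod_nonneg fun t _ => hp.1 _
    have hA : 0 ≤ (if x ∈ typical 𝒲 p h u n then innocent p n x else 0) := by
      split_ifs <;> simp [hx0]
    have hB : 0 ≤ (if n * -h ≤ ∑ t, Real.logb 2 (p (x t)) then ∏ t, p (x t) else 0) := by
      split_ifs
      · exact hx0
      · exact le_rfl
    have hD : ∀ W, 0 ≤ (if n * u ≤ ∑ t, -Real.logb 2 (marginal p W (restrict W (x t)))
        then ∏ t, p (x t) else 0) := fun W => by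
      split_ifs
      · exact hx0
      · exact le_rfl
    have hD' := Finset.sum_nonneg fun W (_ : W ∈ 𝒲) => hD W
    rcases hx0.eq_or_lt with h0 | h0
    · rw [← h0]; rw [← h0] at hA; linarith
    have hpos : ∀ t, 0 < p (x t) := fun t => (hp.1 _).lt_of_ne fun h =>
      h0.ne' (Finset.prod_eq_zero (Finset.mem_univ t) h.symm)
    by_cases hx : x ∈ typical 𝒲 p h u n
    · rw [if_pos hx]; linarith
    by_cases h1 : n * -h ≤ ∑ t, Real.logb 2 (p (x t))
    · rw [if_pos h1]; rw [if_pos h1] at hB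
      change innocent p n x ≤ _ + (innocent p n x + _)
      linarith
    have hh1 : innocent p n x ≤ 2 ^ (-(n * h)) := by
      rw [innocent, prod_eq_two_rpow_sum_logb hpos]
      exact Real.rpow_le_rpow_of_exponent_le one_le_two (by linarith)
    simp only [typical, Finset.mem_filter, Finset.mem_univ, true_and, hh1] at hx
    push Not at hx
    obtain ⟨W, hW, hlt⟩ := hx
    have hmpos : ∀ t, 0 < marginal p W (restrict W (x t)) := fun t =>
      (hpos t).trans_le (le_push _ hp.1 _)
    have h2 : n * u ≤ ∑ t, -Real.logb 2 (marginal p W (restrict W (x t))) := by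
      rw [push_observe_innocent] at hlt
      change ∏ t, marginal p W (restrict W (x t)) < _ at hlt
      rw [prod_eq_two_rpow_sum_logb hmpos, Real.rpow_lt_rpow_left_iff one_lt_two] at hlt
      rw [Finset.sum_neg_distrib]; linarith
    have h3 := Finset.single_le_sum (f := fun W =>
      if n * u ≤ ∑ t, -Real.logb 2 (marginal p W (restrict W (x t))) then ∏ t, p (x t) else 0)
      (fun W _ => hD W) hW
    simp only [if_pos h2] at h3
    change innocent p n x ≤ _ at h3
    linarith
  have hsum := Finset.sum_le_sum fun x (_ : x ∈ Finset.univ) => hpoint x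
  rw [(innocent_mem_stdSimplex hp).2, Finset.sum_add_distrib, Finset.sum_add_distrib,
    Finset.sum_ite_mem, Finset.univ_inter, Finset.sum_comm (s := Finset.univ) (t := 𝒲)] at hsum
  have h1 := hρ n
  have h2 := Finset.sum_le_sum fun W (hW : W ∈ 𝒲) => hσ W hW n
  linarith

/-- Since observations of typical codewords have probability at least `2 ^ (-n u)`, there are at
most `2 ^ (n u)` of them. -/
theorem card_image_typical_le {C : ℕ} {𝒲 : Finset (Finset (Fin C))} {p : Symbol C → ℝ}
    (hp : p ∈ stdSimplex ℝ (Symbol C)) (h u : ℝ) (n : ℕ) {W : Finset (Fin C)} (hW : W ∈ 𝒲) :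
    (((typical 𝒲 p h u n).image (observe W)).card : ℝ) ≤ 2 ^ (n * u) := by
  have hs := push_mem_stdSimplex (observe W) (innocent_mem_stdSimplex (n := n) hp)
  have h1 : (((typical 𝒲 p h u n).image (observe W)).card : ℝ) * 2 ^ (-(n * u)) ≤ 1 := by
    rw [← nsmul_eq_mul, ← hs.2]
    refine (Finset.card_nsmul_le_sum _ (push (observe W) (innocent p n)) _ fun y hy => ?_).trans
      (Finset.sum_le_univ_sum_of_nonneg hs.1)
    obtain ⟨x, hx, rfl⟩ := Finset.mem_image.1 hy
    exact (Finset.mem_filter.1 hx).2.2 W hW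
  rw [Real.rpow_neg zero_le_two] at h1
  exact (div_le_one (by positivity)).1 h1

end Typical

/-! ### The scheme of a codebook -/

section CodebookScheme

variable {C n k l : ℕ}

/-- The scheme of a codebook: Bob takes Alice to be active when he receives a codeword, and then
outputs a message to which that codeword belongs. -/
noncomputable def codebookScheme (c : Bits k × Bits l → Codeword C n) : Scheme C n k l :=
  open Classical in
  { enc := fun m s => c (m, s)
    decT := fun x => decide (∃ i, c i = x)
    decM := fun x => if h : ∃ i, c i = x then h.choose.1 else default }

theorem codebookScheme_enc (c : Bits k × Bits l → Codeword C n) (m : Bits k) (s : Bits l) :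
    (codebookScheme c).enc m s = c (m, s) := rfl

theorem codebookScheme_reliable (c : Bits k × Bits l → Codeword C n) {pinn : Symbol C → ℝ}
    (hpinn : ∀ x, 0 ≤ pinn x) {ε : ℝ}
    (h : (∑ i, innocent pinn n (c i)) + (∑ i, ∑ j, if i ≠ j ∧ c i = c j then 1 else 0)
        / ((2 : ℝ) ^ k * 2 ^ l) ≤ ε) :
    (codebookScheme c).Reliable pinn ε := by
  have hinn : ∀ x, 0 ≤ innocent pinn n x := fun x => Finset.prod_nonneg fun t _ => hpinn _
  have hfa : (∑ x, if (codebookScheme c).decT x = true then innocent pinn n x else 0)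
      ≤ ∑ i, innocent pinn n (c i) := by
    calc _ ≤ ∑ x, ∑ i, if c i = x then innocent pinn n x else 0 := by
          refine Finset.sum_le_sum fun x _ => ?_
          have h0 : ∀ i, 0 ≤ if c i = x then innocent pinn n x else 0 := fun i => by
            split_ifs <;> simp [hinn x]
          split_ifs with hx
          · obtain ⟨i, hi⟩ : ∃ i, c i = x := by simpa [codebookScheme] using hx
            have := Finset.single_le_sum (fun i _ => h0 i) (Finset.mem_univ i)
            simpa [hi] using this
          · exact Finset.sum_nonneg fun i _ => h0 i
      _ = _ := by rw [Finset.sum_comm]; simp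
  have hmd : activeProb (fun m s => (codebookScheme c).decT ((codebookScheme c).enc m s) = false)
      = 0 := by
    have : ∀ m s, (codebookScheme c).decT ((codebookScheme c).enc m s) = true := fun m s => by
      simp [codebookScheme]
    simp [activeProb, this]
  have hdec : activeProb (fun m s => (codebookScheme c).decM ((codebookScheme c).enc m s) ≠ m)
      ≤ (∑ i, ∑ j, if i ≠ j ∧ c i = c j then 1 else 0) / ((2 : ℝ) ^ k * 2 ^ l) := by
    rw [Fintype.sum_prod_type, Finset.sum_div]
    refine Finset.sum_le_sum fun m _ => ?_
    rw [Finset.sum_div]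
    refine Finset.sum_le_sum fun s _ => ?_
    have h0 : ∀ j, (0 : ℝ) ≤ if (m, s) ≠ j ∧ c (m, s) = c j then 1 else 0 := fun j => by
      split_ifs <;> norm_num
    split_ifs with hE
    · have hex : ∃ i, c i = c (m, s) := ⟨_, rfl⟩
      have hne : (m, s) ≠ hex.choose := fun he => hE (by
        rw [codebookScheme_enc]
        simp only [codebookScheme, dif_pos hex, ← he])
      have h1 := Finset.single_le_sum (fun j _ => h0 j) (Finset.mem_univ hex.choose)
      rw [if_pos ⟨hne, hex.choose_spec.symm⟩] at h1
      rw [one_div_mul_one_div]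
      exact div_le_div_of_nonneg_right h1 (by positivity)
    · exact div_nonneg (Finset.sum_nonneg fun j _ => h0 j) (by positivity)
  rw [Scheme.Reliable, hmd]
  linarith

/-- Over the private randomness, the codewords of each message are distributed over the values of
`f` like `q`, up to a relative error `η` at every value. -/
def Equidistributed {γ : Type*} [DecidableEq γ] (S : Scheme C n k l) (f : Codeword C n → γ)
    (q : γ → ℝ) (η : ℝ) : Prop :=
  ∀ m y, |(∑ s, if f (S.enc m s) = y then 1 else 0) - 2 ^ l * q y| ≤ η * (2 ^ l * q y)

theorem activeProb_observation_message {γ : Type*} [DecidableEq γ] (S : Scheme C n k l)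
    (f : Codeword C n → γ) (m : Bits k) (y : γ) :
    activeProb (fun m' s => m' = m ∧ f (S.enc m' s) = y)
      = 1 / 2 ^ k * (1 / 2 ^ l * ∑ s, if f (S.enc m s) = y then 1 else 0) := by
  simp only [activeProb]
  rw [Finset.sum_eq_single m (fun m' _ h => by simp [h]) (by simp)]
  simp only [Finset.mul_sum, mul_ite, mul_zero, mul_one, true_and]

theorem sum_activeProb_message {γ : Type*} [DecidableEq γ] (S : Scheme C n k l)
    (f : Codeword C n → γ) (y : γ) :
    ∑ m, activeProb (fun m' s => m' = m ∧ f (S.enc m' s) = y)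
      = activeProb (fun m s => f (S.enc m s) = y) := by
  rw [← sum_activeProb (fun m _ => m) fun _ m s => f (S.enc m s) = y]
  exact Finset.sum_congr rfl fun m _ => by simp only [and_comm]

namespace Equidistributed

variable {γ : Type*} [DecidableEq γ] {S : Scheme C n k l} {f : Codeword C n → γ} {q : γ → ℝ}
  {η : ℝ}

theorem abs_message_sub_le (h : Equidistributed S f q η) (m : Bits k) (y : γ) :
    |activeProb (fun m' s => m' = m ∧ f (S.enc m' s) = y) - 1 / 2 ^ k * q y|
      ≤ 1 / 2 ^ k * (η * q y) := by
  have hd : activeProb (fun m' s => m' = m ∧ f (S.enc m' s) = y) - 1 / 2 ^ k * q y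
      = 1 / 2 ^ k * (1 / 2 ^ l) * ((∑ s, if f (S.enc m s) = y then 1 else 0) - 2 ^ l * q y) := by
    rw [activeProb_observation_message]; field_simp
  rw [hd, abs_mul, abs_of_pos (by positivity)]
  refine (mul_le_mul_of_nonneg_left (h m y) (by positivity)).trans_eq ?_
  field_simp

theorem abs_sub_le (h : Equidistributed S f q η) (y : γ) :
    |activeProb (fun m s => f (S.enc m s) = y) - q y| ≤ η * q y := by
  have hc : ∀ r : ℝ, ∑ _m : Bits k, 1 / 2 ^ k * r = r := fun r => by
    simp [Finset.sum_const]
  rw [← sum_activeProb_message, ← hc (q y), ← Finset.sum_sub_distrib]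
  refine (Finset.abs_sum_le_sum_abs _ _).trans
    ((Finset.sum_le_sum fun m _ => h.abs_message_sub_le m y).trans_eq ?_)
  rw [hc, hc]

theorem ratio_mem (h : Equidistributed S f q η) {ε : ℝ} (hη : 0 < η) (hη2 : η ≤ 1 / 2)
    (hε : 4 * η ≤ ε) (m : Bits k) (y : γ) (hpos : 0 < activeProb fun m s => f (S.enc m s) = y) :
    (activeProb (fun m' s => m' = m ∧ f (S.enc m' s) = y)
        / activeProb (fun m' s => f (S.enc m' s) = y))
      / activeProb (fun (m' : Bits k) (_ : Bits l) => m' = m) ∈ Set.Icc (1 - ε) (1 + ε) := by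
  set a := activeProb fun m s => f (S.enc m s) = y
  set b := activeProb fun m' s => m' = m ∧ f (S.enc m' s) = y
  obtain ⟨ha1, ha2⟩ := abs_le.1 (h.abs_sub_le y)
  obtain ⟨hb1, hb2⟩ := abs_le.1 (h.abs_message_sub_le m y)
  change -(η * q y) ≤ a - q y at ha1
  change a - q y ≤ η * q y at ha2
  change -(1 / 2 ^ k * (η * q y)) ≤ b - 1 / 2 ^ k * q y at hb1
  change b - 1 / 2 ^ k * q y ≤ 1 / 2 ^ k * (η * q y) at hb2
  have hq : 0 < q y := by
    have : 0 < (1 + η) * q y := by linarith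
    exact (mul_pos_iff_of_pos_left (by linarith)).1 this
  have hN : (0 : ℝ) < 1 / 2 ^ k := by positivity
  set N : ℝ := 1 / 2 ^ k
  have hb1' : N * ((1 - η) * q y) ≤ b := by linarith
  have hb2' : b ≤ N * ((1 + η) * q y) := by linarith
  rw [activeProb_message, div_div, Set.mem_Icc, le_div_iff₀ (by positivity),
    div_le_iff₀ (by positivity)]
  constructor
  · refine le_trans ?_ hb1'
    have h1 : (1 - ε) * a ≤ (1 - η) * q y := by
      have h2 : (1 - ε) * a ≤ (1 - 4 * η) * a := mul_le_mul_of_nonneg_right (by linarith) hpos.le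
      nlinarith [mul_pos hη hq]
    calc (1 - ε) * (a * N) = N * ((1 - ε) * a) := by ring
      _ ≤ _ := mul_le_mul_of_nonneg_left h1 hN.le
  · refine hb2'.trans ?_
    have h1 : (1 + η) * q y ≤ (1 + ε) * a := by
      have h2 : (1 + 4 * η) * a ≤ (1 + ε) * a := mul_le_mul_of_nonneg_right (by linarith) hpos.le
      have h3 : (1 + 4 * η) * ((1 - η) * q y) ≤ (1 + 4 * η) * a :=
        mul_le_mul_of_nonneg_left (by linarith) (by linarith)
      nlinarith [mul_nonneg (mul_pos hη hq).le (by linarith : 0 ≤ 1 - 2 * η)]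
    calc N * ((1 + η) * q y) ≤ N * ((1 + ε) * a) := mul_le_mul_of_nonneg_left h1 hN.le
      _ = _ := by ring

theorem tvDist_le [Fintype γ] (h : Equidistributed S f q η) (hq : q ∈ stdSimplex ℝ γ) :
    tvDist q (push f S.induced) ≤ η / 2 := by
  have h1 : ∑ y, |q y - push f S.induced y| ≤ η := by
    calc _ ≤ ∑ y, η * q y := Finset.sum_le_sum fun y _ => by
            rw [abs_sub_comm, S.push_induced]; exact h.abs_sub_le y
      _ = η := by rw [← Finset.mul_sum, hq.2, mul_one]
  rw [tvDist]; linarith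

end Equidistributed

theorem tvDist_triangle {α : Type*} [Fintype α] (p q r : α → ℝ) :
    tvDist p r ≤ tvDist p q + tvDist q r := by
  rw [tvDist, tvDist, tvDist, ← mul_add, ← Finset.sum_add_distrib]
  exact mul_le_mul_of_nonneg_left
    (Finset.sum_le_sum fun a _ => abs_sub_le (p a) (q a) (r a)) (by norm_num)

theorem tvDist_push_le {α β : Type*} [Fintype α] [Fintype β] [DecidableEq β] (f : α → β)
    (p q : α → ℝ) : tvDist (push f p) (push f q) ≤ tvDist p q := by
  rw [tvDist, tvDist]
  refine mul_le_mul_of_nonneg_left ?_ (by norm_num)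
  rw [← sum_push f fun a => |p a - q a|]
  refine Finset.sum_le_sum fun b _ => ?_
  rw [push, push, push, ← Finset.sum_sub_distrib]
  refine (Finset.abs_sum_le_sum_abs _ _).trans (Finset.sum_le_sum fun a _ => ?_)
  split_ifs <;> simp

end CodebookScheme

/-! ### Conditioning a distribution -/

section Conditioning

variable {α : Type*} [Fintype α] [DecidableEq α]

/-- The distribution `p` conditioned on the event `G`. -/
noncomputable def conditioned (p : α → ℝ) (G : Finset α) (a : α) : ℝ :=
  if a ∈ G then p a / ∑ b ∈ G, p b else 0

omit [Fintype α] in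
theorem sum_conditioned (p : α → ℝ) (G A : Finset α) :
    ∑ a ∈ A, conditioned p G a = (∑ a ∈ G ∩ A, p a) / ∑ b ∈ G, p b := by
  simp only [conditioned]
  rw [Finset.sum_ite_mem, Finset.sum_div, Finset.inter_comm]

theorem conditioned_mem_stdSimplex {p : α → ℝ} (hp : ∀ a, 0 ≤ p a) {G : Finset α}
    (hG : 0 < ∑ b ∈ G, p b) : conditioned p G ∈ stdSimplex ℝ α := by
  refine ⟨fun a => ?_, ?_⟩
  · rw [conditioned]; split_ifs
    · exact div_nonneg (hp a) hG.le
    · exact le_rfl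
  · rw [sum_conditioned, Finset.inter_univ, div_self hG.ne']

theorem tvDist_conditioned {p : α → ℝ} (hp : p ∈ stdSimplex ℝ α) {G : Finset α}
    (hG : 0 < ∑ b ∈ G, p b) : tvDist p (conditioned p G) = 1 - ∑ b ∈ G, p b := by
  have hG1 : ∑ b ∈ G, p b ≤ 1 := hp.2 ▸ Finset.sum_le_univ_sum_of_nonneg hp.1
  have h : ∀ a, |p a - conditioned p G a|
      = conditioned p G a + p a - 2 * if a ∈ G then p a else 0 := by
    intro a
    rw [conditioned]
    split_ifs
    · have : p a ≤ p a / ∑ b ∈ G, p b := le_div_self (hp.1 a) hG hG1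
      rw [abs_of_nonpos (by linarith)]; ring
    · rw [sub_zero, abs_of_nonneg (hp.1 a)]; ring
  rw [tvDist]
  simp only [h]
  rw [Finset.sum_sub_distrib, Finset.sum_add_distrib, (conditioned_mem_stdSimplex hp.1 hG).2, hp.2,
    ← Finset.mul_sum, Finset.sum_ite_mem, Finset.univ_inter]
  ring

end Conditioning

/-! ### Achievability -/

section Achievability

open Filter Topology

variable {C : ℕ} {𝒲 : Finset (Finset (Fin C))} {pinn p : Symbol C → ℝ}

/-- A scheme from a random codebook whose words are drawn from the i.i.d. law of a matching
distribution `p`, conditioned on a pruned set of typical codewords: every possible observation of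
such a word has probability at least `2 ^ (-n (u + δ))`. -/
theorem exists_scheme (hpinn : pinn ∈ stdSimplex ℝ (Symbol C)) (hp : p ∈ matching 𝒲 pinn)
    {n k l : ℕ} {h u δ ζ η ε : ℝ} (hε : 0 < ε) (hη : 0 < η) (hη2 : η ≤ 1 / 2) (hζ : ζ ≤ 1 / 4)
    (htyp : 1 - ζ ≤ ∑ x ∈ typical 𝒲 p h u n, innocent p n x)
    (hprune : 𝒲.card * (2 : ℝ) ^ (-(n * δ)) ≤ ζ)
    (hsmall : 2 * ((2 : ℝ) ^ k * 2 ^ l * (2 * 2 ^ (-(n * h)))) + ε * (2 ^ k *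
      ((𝒲.card * (2 : ℝ) ^ (n * u))
        * (2 * Real.exp (-(2 ^ l * 2 ^ (-(n * (u + δ))) * (η ^ 2 / 4)))))) < ε) :
    ∃ S : Scheme C n k l, S.Reliable pinn ε ∧ S.Deniable 𝒲 pinn (2 * ζ + η) ∧
      S.Hidable 𝒲 (4 * η) := by
  set μ := innocent p n with hμ
  have hμs : μ ∈ stdSimplex ℝ (Codeword C n) := innocent_mem_stdSimplex hp.1
  set T := typical 𝒲 p h u n with hT
  set θ : ℝ := 2 ^ (-(n * (u + δ))) with hθ
  have hθ0 : 0 < θ := by positivity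
  let cell : (Σ W : Finset (Fin C), Fin n → W → Bool) → Finset (Codeword C n) :=
    fun z => Finset.univ.filter fun x => observe z.1 x = z.2
  let K : Finset (Σ W : Finset (Fin C), Fin n → W → Bool) :=
    𝒲.sigma fun W => T.image (observe W)
  have hK : (K.card : ℝ) ≤ 𝒲.card * 2 ^ (n * u) := by
    rw [Finset.card_sigma, Nat.cast_sum, ← nsmul_eq_mul]
    exact Finset.sum_le_card_nsmul _ _ _ fun W hW => card_image_typical_le hp.1 h u n hW
  obtain ⟨G, hGT, hGsum, hGcell⟩ := exists_pruned μ cell hθ0.le K T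
  have hKθ : K.card * θ ≤ ζ := by
    refine (mul_le_mul_of_nonneg_right hK hθ0.le).trans (le_trans (le_of_eq ?_) hprune)
    rw [mul_assoc, hθ, ← Real.rpow_add two_pos]
    congr 2; ring
  have hZ : 1 - 2 * ζ ≤ ∑ x ∈ G, μ x := by linarith
  have hZ0 : 1 / 2 ≤ ∑ x ∈ G, μ x := by linarith
  have hZpos : 0 < ∑ x ∈ G, μ x := by linarith
  have hZ1 : ∑ x ∈ G, μ x ≤ 1 := hμs.2 ▸ Finset.sum_le_univ_sum_of_nonneg hμs.1
  set Q := conditioned μ G with hQ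
  have hQs : Q ∈ stdSimplex ℝ (Codeword C n) := conditioned_mem_stdSimplex hμs.1 hZpos
  have hQb : ∀ x, Q x ≤ 2 * 2 ^ (-(n * h)) := by
    intro x
    rw [hQ, conditioned]
    split_ifs with hx
    · have h1 : μ x ≤ 2 ^ (-(n * h)) := (Finset.mem_filter.1 (hGT hx)).2.1
      rw [div_le_iff₀ hZpos]
      have h2 : (0 : ℝ) < 2 ^ (-(n * h)) := by positivity
      nlinarith
    · positivity
  -- Cells emptied by the pruning are never hit by a codeword and need no bound.
  let K' := K.filter fun z => G ∩ cell z ≠ ∅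
  have hK' : ∀ z ∈ K', θ ≤ ∑ x ∈ cell z, Q x := by
    intro z hz
    obtain ⟨hzK, hne⟩ := Finset.mem_filter.1 hz
    have h1 := (hGcell z hzK).resolve_left hne
    rw [hQ, sum_conditioned]
    exact h1.trans (le_div_self (hθ0.le.trans h1) hZpos hZ1)
  have hcard : ∀ j : ℕ, (Fintype.card (Bits j) : ℝ) = 2 ^ j := fun j => by simp
  obtain ⟨c, hcQ, hcK, hcrel⟩ := exists_codebook (A := Bits k) (B := Bits l) hQs
    (innocent_mem_stdSimplex (n := n) hpinn) cell K' hQb hK' hη (by linarith) hε (by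
      refine lt_of_le_of_lt ?_ hsmall
      rw [hcard, hcard]
      have : (K'.card : ℝ) ≤ 𝒲.card * 2 ^ (n * u) :=
        le_trans (by exact_mod_cast Finset.card_filter_le _ _) hK
      gcongr)
  simp only [hcard] at hcK hcrel
  have hpush : ∀ (W : Finset (Fin C)) (y : Fin n → W → Bool),
      ∑ x ∈ cell ⟨W, y⟩, Q x = push (observe W) Q y := fun W y => by
    simp only [cell, push, Finset.sum_filter]
  have hequi : ∀ W ∈ 𝒲, Equidistributed (codebookScheme c) (observe W) (push (observe W) Q) η := by
    intro W hW m y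
    simp only [codebookScheme_enc]
    by_cases hy : G ∩ cell ⟨W, y⟩ = ∅
    · have hz : ∀ s, observe W (c (m, s)) ≠ y := by
        intro s hs
        have hG : c (m, s) ∈ G := by
          by_contra hG
          exact (hcQ (m, s)).ne' (if_neg hG)
        have hmem : c (m, s) ∈ G ∩ cell ⟨W, y⟩ :=
          Finset.mem_inter.2 ⟨hG, Finset.mem_filter.2 ⟨Finset.mem_univ _, hs⟩⟩
        rw [hy] at hmem
        exact absurd hmem (Finset.notMem_empty _)
      have h0 : push (observe W) Q y = 0 := by
        rw [← hpush, hQ, sum_conditioned, hy]; simp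
      simp [hz, h0]
    · obtain ⟨x, hx⟩ := Finset.nonempty_iff_ne_empty.2 hy
      obtain ⟨hxG, hxc⟩ := Finset.mem_inter.1 hx
      have hzK : (⟨W, y⟩ : Σ W : Finset (Fin C), Fin n → W → Bool) ∈ K' :=
        Finset.mem_filter.2 ⟨Finset.mem_sigma.2
          ⟨hW, Finset.mem_image.2 ⟨x, hGT hxG, (Finset.mem_filter.1 hxc).2⟩⟩, hy⟩
      have := hcK m _ hzK
      rw [hpush] at this
      refine le_of_eq_of_le (congrArg (fun N : ℝ => |N - 2 ^ l * push (observe W) Q y|)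
        (Finset.sum_congr rfl fun s _ => ?_)) this
      exact if_congr (by simp [cell]) rfl rfl
  refine ⟨codebookScheme c, codebookScheme_reliable c hpinn.1 hcrel.le, fun W hW => ?_,
    fun m W hW y hpos => (hequi W hW).ratio_mem hη hη2 le_rfl m y hpos⟩
  have hsame : push (observe W) (innocent pinn n) = push (observe W) μ := by
    funext y
    rw [push_observe_innocent, hμ, push_observe_innocent, hp.2 W hW]
  rw [hsame]
  have h1 := tvDist_triangle (push (observe W) μ) (push (observe W) Q)
    (push (observe W) (codebookScheme c).induced)
  have h2 := (hequi W hW).tvDist_le (push_mem_stdSimplex _ hQs)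
  have h3 := tvDist_push_le (observe W) μ Q
  rw [hQ, tvDist_conditioned hμs hZpos, ← hQ] at h3
  linarith

theorem two_pow_ceil_le {a : ℝ} (ha : 0 ≤ a) : (2 : ℝ) ^ ⌈a⌉₊ ≤ 2 * 2 ^ a := by
  rw [← Real.rpow_natCast, mul_comm, ← Real.rpow_add_one two_ne_zero]
  exact Real.rpow_le_rpow_of_exponent_le one_le_two (Nat.ceil_lt_add_one ha).le

theorem two_rpow_le_pow_ceil (a : ℝ) : (2 : ℝ) ^ a ≤ 2 ^ ⌈a⌉₊ := by
  rw [← Real.rpow_natCast]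
  exact Real.rpow_le_rpow_of_exponent_le one_le_two (Nat.le_ceil a)

theorem tendsto_two_rpow_natCast_mul {δ : ℝ} (hδ : 0 < δ) :
    Tendsto (fun n : ℕ => (2 : ℝ) ^ (n * δ)) atTop atTop :=
  (tendsto_rpow_atTop_of_base_gt_one 2 one_lt_two).comp
    (tendsto_natCast_atTop_atTop.atTop_mul_const hδ)

theorem Scheme.Hidable.mono {n k l : ℕ} {S : Scheme C n k l} {ε ε' : ℝ} (h : S.Hidable 𝒲 ε)
    (hε : ε ≤ ε') : S.Hidable 𝒲 ε' := fun m W hW y hy =>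
  Set.Icc_subset_Icc (by linarith) (by linarith) (h m W hW y hy)

theorem Scheme.Deniable.mono {n k l : ℕ} {S : Scheme C n k l} {ε ε' : ℝ}
    (h : S.Deniable 𝒲 pinn ε) (hε : ε ≤ ε') : S.Deniable 𝒲 pinn ε' := fun W hW =>
  (h W hW).trans_le hε

/-- The smallness condition of `exists_scheme` for large blocks. With `z = 2 ^ (n δ)`, false alarms
and collisions contribute `O(1 / z)`, and the union bound over messages and observations costs a
power of `z` against the doubly exponential Chernoff bound `exp (-η² z / 4)`. -/
theorem eventually_coding_error_lt {R r h u δ η ε : ℝ} (w : ℝ) (hR : 0 ≤ R) (hr : 0 ≤ r)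
    (hδ : 0 < δ) (hh : h = R + r + δ) (hu : r = u + 2 * δ) (hw : 0 ≤ w) (hη : 0 < η)
    (hε : 0 < ε) :
    ∀ᶠ n : ℕ in atTop,
      2 * ((2 : ℝ) ^ ⌈n * R⌉₊ * 2 ^ ⌈n * r⌉₊ * (2 * 2 ^ (-(n * h)))) + ε * (2 ^ ⌈n * R⌉₊ *
      ((w * (2 : ℝ) ^ (n * u))
        * (2 * Real.exp (-(2 ^ ⌈n * r⌉₊ * 2 ^ (-(n * (u + δ))) * (η ^ 2 / 4)))))) < ε := by
  have hz : Tendsto (fun n : ℕ => (2 : ℝ) ^ (n * δ)) atTop atTop :=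
    tendsto_two_rpow_natCast_mul hδ
  have hlim : Tendsto (fun z : ℝ => 16 * z⁻¹
      + ε * (4 * w) * (z ^ ((R + u) / δ) * Real.exp (-(η ^ 2 / 4) * z))) atTop (𝓝 0) := by
    have h1 := (tendsto_inv_atTop_zero (𝕜 := ℝ)).const_mul 16
    have h2 := (tendsto_rpow_mul_exp_neg_mul_atTop_nhds_zero ((R + u) / δ) (η ^ 2 / 4)
      (by positivity)).const_mul (ε * (4 * w))
    simpa using h1.add h2
  filter_upwards [(hlim.comp hz).eventually_lt_const hε] with n hn
  refine lt_of_le_of_lt ?_ hn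
  have hk := two_pow_ceil_le (mul_nonneg (Nat.cast_nonneg (α := ℝ) n) hR)
  have hl := two_pow_ceil_le (mul_nonneg (Nat.cast_nonneg (α := ℝ) n) hr)
  have hl' := two_rpow_le_pow_ceil (n * r)
  simp only [Function.comp_apply]
  refine add_le_add ?_ ?_
  · calc 2 * ((2 : ℝ) ^ ⌈n * R⌉₊ * 2 ^ ⌈n * r⌉₊ * (2 * 2 ^ (-(n * h))))
        ≤ 2 * ((2 * 2 ^ (n * R)) * (2 * 2 ^ (n * r)) * (2 * 2 ^ (-(n * h)))) := by gcongr
      _ = 16 * (2 ^ (n * R) * 2 ^ (n * r) * 2 ^ (-(n * h))) := by ring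
      _ = 16 * ((2 : ℝ) ^ (n * δ))⁻¹ := by
          rw [← Real.rpow_add two_pos, ← Real.rpow_add two_pos, ← Real.rpow_neg zero_le_two, hh]
          congr 2; ring
  · have hz2 : (2 : ℝ) ^ (n * δ) ≤ 2 ^ ⌈n * r⌉₊ * 2 ^ (-(n * (u + δ))) := by
      refine le_trans (le_of_eq ?_) (mul_le_mul_of_nonneg_right hl' (by positivity))
      rw [← Real.rpow_add two_pos, hu]
      congr 1; ring
    have hz3 : ((2 : ℝ) ^ (n * δ)) ^ ((R + u) / δ) = 2 ^ (n * R) * 2 ^ (n * u) := by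
      rw [← Real.rpow_mul zero_le_two, ← Real.rpow_add two_pos]
      congr 1; field_simp
    rw [hz3]
    calc ε * (2 ^ ⌈n * R⌉₊ * ((w * (2 : ℝ) ^ (n * u))
          * (2 * Real.exp (-(2 ^ ⌈n * r⌉₊ * 2 ^ (-(n * (u + δ))) * (η ^ 2 / 4))))))
        ≤ ε * ((2 * 2 ^ (n * R)) * ((w * (2 : ℝ) ^ (n * u))
          * (2 * Real.exp (-(2 ^ (n * δ) * (η ^ 2 / 4)))))) := by gcongr
      _ = _ := by
          rw [show -((2 : ℝ) ^ (n * δ) * (η ^ 2 / 4)) = -(η ^ 2 / 4) * 2 ^ (n * δ) by ring]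
          ring

theorem achievable_of_lt (h𝒲 : 𝒲.Nonempty) (hpinn : pinn ∈ stdSimplex ℝ (Symbol C))
    (hp : p ∈ matching 𝒲 pinn) {R : ℝ} (hR : 0 ≤ R)
    (hlt : R < 𝒲.inf' h𝒲 fun W => entropy p - entropy (marginal p W)) :
    Achievable 𝒲 pinn R := by
  obtain ⟨g, hg⟩ : ∃ g, g = (𝒲.inf' h𝒲 fun W => entropy p - entropy (marginal p W)) - R :=
    ⟨_, rfl⟩
  have hg0 : 0 < g := by linarith
  have hgW : ∀ W ∈ 𝒲, R + g ≤ entropy p - entropy (marginal p W) := fun W hW => by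
    have := Finset.inf'_le (fun W => entropy p - entropy (marginal p W)) hW
    linarith
  -- The total rate `R + r` lies `2 δ` below the entropy of a column, and `r` lies at least `3 δ`
  -- above the entropy of every observation.
  set δ := g / 5 with hδ
  have hδ0 : 0 < δ := by positivity
  set r := entropy p - R - 2 * δ with hr
  have hr0 : 0 ≤ r := by
    obtain ⟨W, hW⟩ := h𝒲
    have h1 := hgW W hW
    have h2 : 0 ≤ entropy (marginal p W) := entropy_nonneg (push_mem_stdSimplex _ hp.1)
    linarith
  refine ⟨r, hr0, fun εrel hrel εden hden εhid hhid => ?_⟩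
  set η := min (1 / 2) (min (εden / 2) (εhid / 4)) with hη
  have hη0 : 0 < η := by positivity
  have hη1 : η ≤ 1 / 2 := min_le_left _ _
  have hη2 : η ≤ εden / 2 := (min_le_right _ _).trans (min_le_left _ _)
  have hη3 : η ≤ εhid / 4 := (min_le_right _ _).trans (min_le_right _ _)
  set ζ := min (1 / 4) (εden / 4) with hζ
  have hζ0 : 0 < ζ := by positivity
  have hζ1 : ζ ≤ 1 / 4 := min_le_left _ _
  have hζ2 : ζ ≤ εden / 4 := min_le_right _ _
  have htyp := tendsto_sum_typical (𝒲 := 𝒲) hp.1 (h := entropy p - δ) (u := r - 2 * δ)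
    (by linarith) (fun W hW => by linarith [hgW W hW]) hζ0
  have hprune : ∀ᶠ n : ℕ in atTop, 𝒲.card * (2 : ℝ) ^ (-(n * δ)) ≤ ζ := by
    have h1 := (tendsto_inv_atTop_zero.comp (tendsto_two_rpow_natCast_mul hδ0)).const_mul
      (𝒲.card : ℝ)
    rw [mul_zero] at h1
    filter_upwards [h1.eventually_lt_const hζ0] with n hn
    rw [Real.rpow_neg zero_le_two]
    exact hn.le
  have hsmall := eventually_coding_error_lt (R := R) (r := r) (h := entropy p - δ)
    (u := r - 2 * δ) (𝒲.card : ℝ) hR hr0 hδ0 (by rw [hr]; ring) (by ring) (Nat.cast_nonneg _)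
    hη0 hrel
  obtain ⟨N, hN⟩ := eventually_atTop.1 (htyp.and (hprune.and hsmall))
  refine ⟨N, fun n hn => ?_⟩
  obtain ⟨h1, h2, h3⟩ := hN n hn
  obtain ⟨S, hS1, hS2, hS3⟩ := exists_scheme hpinn hp hrel hη0 hη1 hζ1 h1 h2 h3
  exact ⟨S, hS1, hS2.mono (by linarith), hS3.mono (by linarith)⟩

end Achievability

/-! ### The capacity -/

section Capacity

variable {C : ℕ} {𝒲 : Finset (Finset (Fin C))} {pinn : Symbol C → ℝ}

/-- Rates above the entropy formula are not achievable. -/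
theorem Achievable.exists_le (h𝒲 : 𝒲.Nonempty) (hpinn : pinn ∈ stdSimplex ℝ (Symbol C)) {R : ℝ}
    (hR : Achievable 𝒲 pinn R) : ∃ p ∈ matching 𝒲 pinn,
      R ≤ 𝒲.inf' h𝒲 fun W => entropy p - entropy (marginal p W) := by
  by_contra! hcon
  obtain ⟨δ, hδ, hno⟩ := exists_tolerance_of_lt h𝒲 hpinn hcon
  obtain ⟨r, -, hr⟩ := hR
  obtain ⟨N, hN⟩ := hr δ hδ δ hδ δ hδ
  obtain ⟨S, hS⟩ := hN (max N 1) (le_max_left _ _)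
  exact hno _ _ _ (le_max_right _ _) (Nat.le_ceil _) S hS

theorem bddAbove_matching_entropy (h𝒲 : 𝒲.Nonempty) (pinn : Symbol C → ℝ) :
    BddAbove ((fun p => 𝒲.inf' h𝒲 fun W => entropy p - entropy (marginal p W)) ''
      matching 𝒲 pinn) := by
  obtain ⟨b, hb⟩ := ((isCompact_stdSimplex ℝ (Symbol C)).image continuous_entropy).bddAbove
  refine ⟨b, ?_⟩
  rintro _ ⟨p, hp, rfl⟩
  obtain ⟨W, hW⟩ := h𝒲
  have h1 : entropy p ≤ b := hb ⟨p, hp.1, rfl⟩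
  have h2 : 0 ≤ entropy (marginal p W) := entropy_nonneg (push_mem_stdSimplex _ hp.1)
  exact (Finset.inf'_le _ hW).trans (by linarith)

theorem isLUB_capacity (h𝒲 : 𝒲.Nonempty) (hpinn : pinn ∈ stdSimplex ℝ (Symbol C)) :
    IsLUB ((fun p => 𝒲.inf' h𝒲 fun W => entropy p - entropy (marginal p W)) '' matching 𝒲 pinn)
      (capacity 𝒲 pinn) := by
  have hbdd : BddAbove {R : ℝ | 0 ≤ R ∧ Achievable 𝒲 pinn R} := by
    obtain ⟨b, hb⟩ := bddAbove_matching_entropy h𝒲 pinn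
    refine ⟨b, fun R hR => ?_⟩
    obtain ⟨p, hp, hle⟩ := hR.2.exists_le h𝒲 hpinn
    exact hle.trans (hb ⟨p, hp, rfl⟩)
  have hcap0 : 0 ≤ capacity 𝒲 pinn := Real.sSup_nonneg fun R hR => hR.1
  constructor
  · rintro _ ⟨p, hp, rfl⟩
    refine le_of_forall_lt fun R hR => ?_
    obtain ⟨R', hRR', hR'⟩ := exists_between hR
    rcases lt_or_ge R' 0 with h0 | h0
    · exact (hRR'.trans h0).trans_le hcap0
    · exact hRR'.trans_le (le_csSup hbdd ⟨h0, achievable_of_lt h𝒲 hpinn hp h0 hR'⟩)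
  · intro b hb
    have hb0 : 0 ≤ b := by
      refine le_trans ?_ (hb ⟨pinn, self_mem_matching hpinn, rfl⟩)
      exact (Finset.le_inf'_iff _ _).2 fun W _ => entropy_sub_entropy_marginal_nonneg hpinn.1 W
    refine Real.sSup_le (fun R hR => ?_) hb0
    obtain ⟨p, hp, hle⟩ := hR.2.exists_le h𝒲 hpinn
    exact hle.trans (hb ⟨p, hp, rfl⟩)

end Capacity

end MultipathNet

theorem theorem2 (C : ℕ) (𝒲 : Finset (Finset (Fin C))) (h𝒲 : 𝒲.Nonempty)
    (pinn : MultipathNet.Symbol C → ℝ)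
    (hpinn : pinn ∈ stdSimplex ℝ (MultipathNet.Symbol C)) :
    -- the capacity is the supremum of `min_W [H(p) - H(p_W)]` over the matching distributions
    IsLUB ((fun p => 𝒲.inf' h𝒲 fun W =>
        MultipathNet.entropy p - MultipathNet.entropy (MultipathNet.marginal p W)) ''
          MultipathNet.matching 𝒲 pinn)
      (MultipathNet.capacity 𝒲 pinn) ∧
    -- that is, of `min_W H(X_{Wᶜ} | X_W)`
    IsLUB ((fun p => 𝒲.inf' h𝒲 fun W => MultipathNet.hiddenEntropy p W) ''
          MultipathNet.matching 𝒲 pinn)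
      (MultipathNet.capacity 𝒲 pinn) ∧
    -- achievability
    (∀ R : ℝ, 0 ≤ R → R < MultipathNet.capacity 𝒲 pinn → MultipathNet.Achievable 𝒲 pinn R) ∧
    -- converse, uniformly in the block length and in the amount of private randomness
    (∀ R : ℝ, MultipathNet.capacity 𝒲 pinn < R → ∃ δ > 0, ∀ n k l : ℕ, 1 ≤ n → n * R ≤ k →
      ∀ S : MultipathNet.Scheme C n k l,
        ¬ (S.Reliable pinn δ ∧ S.Deniable 𝒲 pinn δ ∧ S.Hidable 𝒲 δ)) := by
  have hlub := MultipathNet.isLUB_capacity h𝒲 hpinn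
  refine ⟨hlub, ?_, fun R hR hlt => ?_, fun R hlt => ?_⟩
  · convert hlub using 1
    refine Set.image_congr fun p hp => ?_
    simp only [MultipathNet.hiddenEntropy_eq hp.1.1]
  · obtain ⟨_, ⟨p, hp, rfl⟩, hRp⟩ := (lt_isLUB_iff hlub).1 hlt
    exact MultipathNet.achievable_of_lt h𝒲 hpinn hp hR hRp
  · exact MultipathNet.exists_tolerance_of_lt h𝒲 hpinn fun p hp =>
      (hlub.1 ⟨p, hp, rfl⟩).trans_lt hlt
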